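/- Let $n\ge 1$ and let $W$ be a finite irreducible real reflection group acting on $\mathbf R^n$; roots of $W$ (and of its reflection subgroups) are normalised to be unit vectors, and $R(v)$ denotes the reflection in $v^\perp$. Let $\alpha_1,\dots,\alpha_n$ be a simple system of $W$ (the inward unit normals of a fundamental chamber), ordered so that for some $s$ both $\{\alpha_1,\dots,\alpha_s\}$ and $\{\alpha_{s+1},\dots,\alpha_n\}$ are orthonormal sets. Let $\gamma=R(\alpha_1)\cdots R(\alpha_n)$ be the corresponding Coxeter element and let $h$ be its order. The positive roots of $W$ are ordered as $\rho_1,\dots,\rho_{nh/2}$, where $\rho_i=R(\alpha_1)R(\alpha_2)\cdots R(\alpha_{i-1})\alpha_i$ with the indices of the $\alpha$'s taken cyclically modulo $n$. For $w\in W$ let $M(w)=\operatorname{im}(w-I)$, let $l(w)$ be the least number of reflections of $W$ whose product is $w$ (so $l(I)=0$), and write $u\le w$ if $l(w)=l(u)+l(u^{-1}w)$. Let $\sigma\in W$ satisfy $\sigma\le\gamma$, let $k=l(\sigma)$, and let $P$ be the set of positive roots $\tau$ with $R(\tau)\le\sigma$. Then $P$ contains exactly one simple system $\Delta$ of the reflection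 group $\{w\in W\mid M(w)\subseteq M(\sigma)\}$, and $\Delta$ has $k$ elements. List them as $\delta_1,\dots,\delta_k$ in increasing order with respect to the order $\rho_1,\rho_2,\dots,\rho_{nh/2}$. Then, for each $i=1,\dots,k$, $\delta_i$ is the last positive root in the subspace $$M\bigl(\sigma R(\delta_k)R(\delta_{k-1})\cdots R(\delta_{i+1})\bigr),$$ and $(\delta_1,\dots,\delta_k)$ is the only $k$-tuple of vectors with this property, so that the simple system is determined recursively. In particular, if $k\ge 1$, then $\delta_k$ is the last element of $P$. -/

import Mathlib

noncomputable section

namespace BradyWatt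

variable {V : Type*} [NormedAddCommGroup V] [InnerProductSpace ℝ V]

/-- The orthogonal reflection `R(v)` in the hyperplane `v^⊥` (for a unit vector `v` this is
`x ↦ x - 2 (v · x) v`). -/
def rootRefl (v : V) : V ≃ₗᵢ[ℝ] V := (ℝ ∙ v)ᗮ.reflection

/-- The moved space `M(A) = im (A - I)`. -/
def movedSpace (A : V ≃ₗᵢ[ℝ] V) : Submodule ℝ V :=
  LinearMap.range ((A.toLinearEquiv : V →ₗ[ℝ] V) - LinearMap.id)

/-- The reflection set of `W`. -/
def reflections (W : Subgroup (V ≃ₗᵢ[ℝ] V)) : Set (V ≃ₗᵢ[ℝ] V) :=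
  {w | w ∈ W ∧ ∃ v : V, ‖v‖ = 1 ∧ w = rootRefl v}

/-- The roots of `W`, normalised to be unit vectors. -/
def roots (W : Subgroup (V ≃ₗᵢ[ℝ] V)) : Set V :=
  {β | ‖β‖ = 1 ∧ rootRefl β ∈ W}

/-- `W` is a finite real reflection group acting irreducibly. -/
structure IsFiniteIrreducibleReflectionGroup (W : Subgroup (V ≃ₗᵢ[ℝ] V)) : Prop where
  finite : Finite W
  generated : Subgroup.closure (reflections W) = W
  irreducible : ∀ U : Submodule ℝ V, (∀ w ∈ W, ∀ x ∈ U, w x ∈ U) → U = ⊥ ∨ U = ⊤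

/-- The reflection length `l(w)`: the least `k` such that `w` is a product of `k` reflections
of `W` (with `l(I) = 0`). -/
def reflLength (W : Subgroup (V ≃ₗᵢ[ℝ] V)) (w : V ≃ₗᵢ[ℝ] V) : ℕ :=
  sInf {k | ∃ L : List (V ≃ₗᵢ[ℝ] V), (∀ r ∈ L, r ∈ reflections W) ∧ L.length = k ∧ L.prod = w}

/-- The partial order on `W` given by reflection length. -/
def absLE (W : Subgroup (V ≃ₗᵢ[ℝ] V)) (u w : V ≃ₗᵢ[ℝ] V) : Prop :=
  reflLength W w = reflLength W u + reflLength W (u⁻¹ * w)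

/-- `Δ` is a simple system for `W`: linearly independent roots such that every root is a linear
combination of `Δ` with all coefficients of the same sign. -/
structure IsSimpleSystem (W : Subgroup (V ≃ₗᵢ[ℝ] V)) (Δ : Set V) : Prop where
  subset_roots : Δ ⊆ roots W
  linearIndep : LinearIndepOn ℝ id Δ
  same_sign : ∀ β ∈ roots W, β ∈ PointedCone.hull ℝ Δ ∨ -β ∈ PointedCone.hull ℝ Δ

/-- The subgroup `{w ∈ W | M(w) ⊆ U}`. -/
def movedSubgroup (W : Subgroup (V ≃ₗᵢ[ℝ] V)) (U : Submodule ℝ V) :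
    Subgroup (V ≃ₗᵢ[ℝ] V) where
  carrier := {w | w ∈ W ∧ movedSpace w ≤ U}
  one_mem' := by
    refine ⟨W.one_mem, ?_⟩
    rintro _ ⟨x, rfl⟩
    simp
  mul_mem' := by
    rintro a b ⟨ha, ha'⟩ ⟨hb, hb'⟩
    refine ⟨W.mul_mem ha hb, ?_⟩
    rintro _ ⟨x, rfl⟩
    have h := U.add_mem (ha' ⟨b x, rfl⟩) (hb' ⟨x, rfl⟩)
    simpa using h
  inv_mem' := by
    rintro a ⟨ha, ha'⟩
    refine ⟨W.inv_mem ha, ?_⟩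
    rintro _ ⟨x, rfl⟩
    have h := U.neg_mem (ha' ⟨a⁻¹ x, rfl⟩)
    have hx : a (a⁻¹ x) = x := a.apply_symm_apply x
    simpa [hx] using h

section Coxeter

variable {n : ℕ} [NeZero n] (α : Fin n → V)

/-- The product `R(α_1) ⋯ R(α_j)`, indices taken cyclically modulo `n`. -/
def prefixProd (j : ℕ) : V ≃ₗᵢ[ℝ] V :=
  ((List.range j).map fun m => rootRefl (α (Fin.ofNat n m))).prod

/-- The Coxeter element `γ = R(α_1) ⋯ R(α_n)`. -/
def coxeterElt : V ≃ₗᵢ[ℝ] V := prefixProd α n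

/-- `rho α j` is the root `ρ_{j+1} = R(α_1) ⋯ R(α_j) α_{j+1}`, indices taken cyclically
modulo `n`. -/
def rho (j : ℕ) : V := prefixProd α j (α (Fin.ofNat n j))

/-- The positive roots of `W` with respect to the simple roots `α`. -/
def posRoots (W : Subgroup (V ≃ₗᵢ[ℝ] V)) : Set V :=
  {β | β ∈ roots W ∧ β ∈ PointedCone.hull ℝ (Set.range α)}

/-- `β` comes strictly before `β'` in the sequence `ρ_1, …, ρ_{nh/2}`, where `h` is the order
of the Coxeter element. -/
def Before (β β' : V) : Prop :=
  ∃ i j : ℕ, i < j ∧ j < n * orderOf (coxeterElt α) / 2 ∧ rho α i = β ∧ rho α j = β'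

/-- `δ` is the last element of the set `S` of positive roots. -/
def IsLastIn (S : Set V) (δ : V) : Prop :=
  δ ∈ S ∧ ∀ β ∈ S, β ≠ δ → Before α β δ

/-- `P`: the positive roots whose reflections precede `σ`. -/
def posRootsBelow (W : Subgroup (V ≃ₗᵢ[ℝ] V)) (σ : V ≃ₗᵢ[ℝ] V) : Set V :=
  {β | β ∈ posRoots α W ∧ absLE W (rootRefl β) σ}

end Coxeter

/-- `σ R(δ_k) R(δ_{k-1}) ⋯ R(δ_{i+1})` (here `i : Fin k` stands for the index `i + 1` of the
one-based numbering `δ_1, …, δ_k`). -/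
def tailElt {k : ℕ} (σ : V ≃ₗᵢ[ℝ] V) (δ : Fin k → V) (i : Fin k) : V ≃ₗᵢ[ℝ] V :=
  σ * ((((List.ofFn δ).drop (i + 1)).reverse).map rootRefl).prod

/-- For every `i`, the vector `δ_i` is the last positive root in the subspace
`M(σ R(δ_k) ⋯ R(δ_{i+1}))`. -/
def SatisfiesRecursion {n : ℕ} [NeZero n] (α : Fin n → V) (W : Subgroup (V ≃ₗᵢ[ℝ] V))
    {k : ℕ} (σ : V ≃ₗᵢ[ℝ] V) (δ : Fin k → V) : Prop :=
  ∀ i : Fin k, IsLastIn α {β | β ∈ posRoots α W ∧ β ∈ movedSpace (tailElt σ δ i)} (δ i)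

end BradyWatt

end

noncomputable section

namespace BradyWatt

open scoped InnerProductSpace

/-! ### Reflections and moved spaces of isometries. -/

section Reflections

variable {V : Type*} [NormedAddCommGroup V] [InnerProductSpace ℝ V]

/-! Positive roots are compared through the linear map `μ = 2 (1 - γ)⁻¹`, which exists because `γ`
fixes no nonzero vector. Three facts carry the argument. First, `⟪μ x, x⟫ = ⟪x, x⟫`. Second, `μ ρ_i`
is a translate of a fundamental weight, so `⟪μ ρ_i, ρ_j⟫` is a simple coordinate of `ρ_j` pulled
back by a prefix of the Coxeter word; it is nonnegative for `i ≤ j` and nonpositive for `i > j`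
(`IsSimpleSystem.inner_eulerMap_nonneg`, `IsSimpleSystem.inner_eulerMap_nonpos`). Third, if `σ ≤ γ`
and `δ` is a root in `M(σ)`, then `σ R(δ) ≤ γ`, and `M(σ R(δ))` is the hyperplane `⟪μ u, δ⟫ = 0` of
`M(σ)` (`IsSimpleSystem.mul_rootRefl_below`).

By Carter's lemma (`IsSimpleSystem.reflLength_eq`), `P` is the set of positive roots in `M(σ)`, and
it contains exactly one simple system `D`. Let `l` be the last root of `P`. If `l` were not in `D`,
then `⟪μ l, ·⟫` would be nonpositive on `D`, hence at `l`, against `⟪μ l, l⟫ = 1`. The functional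
`⟪μ ·, l⟫` is nonnegative on `D`, so its zeros in `D` form a simple system for `M(σ R(l))`.
Induction on `dim M(σ)` handles `σ R(l)`, and a count shows that `D` is the simple system found
there together with `l` (`IsRhoEnumeration.exists_simple`). Order and recursion come out together.

All this needs `ρ_1, …, ρ_{nh/2}` to be exactly the positive roots. A Perron-Frobenius eigenvector
of the Gram matrix provides the Coxeter plane, on which `γ` rotates through `2θ`; the projection of
`ρ_j` has an angle given by its block, signs of sines decide the sign of `ρ_j`, and `θ = π / h`
(`IsSimpleSystem.rho_sign`). -/

lemma isometry_mul_apply (a b : V ≃ₗᵢ[ℝ] V) (x : V) : (a * b) x = a (b x) := rfl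

lemma rootRefl_apply {v : V} (hv : ‖v‖ = 1) (x : V) :
    rootRefl v x = x - (2 * ⟪v, x⟫_ℝ) • v := by
  rw [rootRefl, Submodule.reflection_orthogonal_apply, Submodule.reflection_singleton_apply]
  simp [hv, mul_smul, two_smul]

lemma rootRefl_self (v : V) : rootRefl v v = -v :=
  Submodule.reflection_orthogonalComplement_singleton_eq_neg v

@[simp] lemma rootRefl_mul_self (v : V) : rootRefl v * rootRefl v = 1 :=
  Submodule.reflection_mul_reflection _

@[simp] lemma rootRefl_rootRefl (v x : V) : rootRefl v (rootRefl v x) = x :=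
  Submodule.reflection_reflection _ x

@[simp] lemma rootRefl_inv (v : V) : (rootRefl v)⁻¹ = rootRefl v :=
  Submodule.reflection_inv

lemma rootRefl_mul_cancel_left (v : V) (w : V ≃ₗᵢ[ℝ] V) : rootRefl v * (rootRefl v * w) = w := by
  rw [← mul_assoc, rootRefl_mul_self, one_mul]

lemma rootRefl_neg (v : V) : rootRefl (-v) = rootRefl v := by
  have : (ℝ ∙ (-v)) = ℝ ∙ v := by
    simpa using Submodule.span_singleton_group_smul_eq ℝ (-1 : ℝˣ) v
  simp [rootRefl, this]

lemma rootRefl_conj {v : V} (hv : ‖v‖ = 1) (w : V ≃ₗᵢ[ℝ] V) :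
    w * rootRefl v * w⁻¹ = rootRefl (w v) := by
  ext x
  have hw : w (w⁻¹ x) = x := w.apply_symm_apply x
  have h : ⟪v, w⁻¹ x⟫_ℝ = ⟪w v, x⟫_ℝ := by
    rw [← w.inner_map_map, hw]
  rw [rootRefl_apply (by simpa using hv)]
  simp only [isometry_mul_apply]
  rw [rootRefl_apply hv, map_sub, hw, map_smul, h]

lemma mem_movedSpace {w : V ≃ₗᵢ[ℝ] V} {x : V} : x ∈ movedSpace w ↔ ∃ y, w y - y = x :=
  Iff.rfl

lemma sub_mem_movedSpace (w : V ≃ₗᵢ[ℝ] V) (y : V) : w y - y ∈ movedSpace w := ⟨y, rfl⟩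

lemma inner_eq_zero_of_mem_movedSpace {w : V ≃ₗᵢ[ℝ] V} {u x : V} (hu : u ∈ movedSpace w)
    (hx : w x = x) : ⟪u, x⟫_ℝ = 0 := by
  obtain ⟨y, rfl⟩ := mem_movedSpace.mp hu
  have : ⟪w y, x⟫_ℝ = ⟪y, x⟫_ℝ := by
    conv_lhs => rw [← hx]
    exact w.inner_map_map y x
  rw [inner_sub_left, this, sub_self]

/-- Since `w` preserves norms, `‖w x - x‖² = -2 ⟪w x - x, x⟫`, which vanishes once `x` is orthogonal
to the moved space. -/
lemma fixed_iff {w : V ≃ₗᵢ[ℝ] V} {x : V} :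
    w x = x ↔ ∀ u ∈ movedSpace w, ⟪u, x⟫_ℝ = 0 := by
  refine ⟨fun hx u hu => inner_eq_zero_of_mem_movedSpace hu hx, fun h => ?_⟩
  have h1 := h _ (sub_mem_movedSpace w x)
  have h2 : ⟪w x - x, w x⟫_ℝ = -⟪w x - x, x⟫_ℝ := by
    rw [inner_sub_left, inner_sub_left, w.inner_map_map, real_inner_comm x (w x)]
    ring
  have h3 : ⟪w x - x, w x - x⟫_ℝ = 0 := by
    rw [inner_sub_right, h2, h1]; simp
  exact sub_eq_zero.mp (inner_self_eq_zero.mp h3)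

lemma mem_movedSpace_iff_fixed [FiniteDimensional ℝ V] {w : V ≃ₗᵢ[ℝ] V} {u : V} :
    u ∈ movedSpace w ↔ ∀ x, w x = x → ⟪u, x⟫_ℝ = 0 := by
  refine ⟨fun hu x hx => inner_eq_zero_of_mem_movedSpace hu hx, fun h => ?_⟩
  rw [← Submodule.orthogonal_orthogonal (movedSpace w), Submodule.mem_orthogonal]
  intro x hx
  rw [real_inner_comm]
  refine h x (fixed_iff.mpr fun u hu => ?_)
  exact (Submodule.mem_orthogonal _ _).mp hx u hu

@[simp] lemma movedSpace_one : movedSpace (1 : V ≃ₗᵢ[ℝ] V) = ⊥ := by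
  rw [eq_bot_iff]
  rintro _ ⟨y, rfl⟩
  simp

lemma movedSpace_mul_le (a b : V ≃ₗᵢ[ℝ] V) :
    movedSpace (a * b) ≤ movedSpace a ⊔ movedSpace b := by
  intro u hu
  obtain ⟨y, rfl⟩ := mem_movedSpace.mp hu
  rw [show (a * b) y - y = (a (b y) - b y) + (b y - y) by
    rw [isometry_mul_apply]; abel]
  exact Submodule.add_mem_sup (sub_mem_movedSpace _ _) (sub_mem_movedSpace _ _)

lemma movedSpace_inv (w : V ≃ₗᵢ[ℝ] V) : movedSpace w⁻¹ = movedSpace w := by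
  have key : ∀ w : V ≃ₗᵢ[ℝ] V, movedSpace w⁻¹ ≤ movedSpace w := by
    intro w u hu
    obtain ⟨y, rfl⟩ := mem_movedSpace.mp hu
    have hw : w (w⁻¹ y) = y := w.apply_symm_apply y
    have h := sub_mem_movedSpace w (-(w⁻¹ y))
    rw [map_neg, hw] at h
    convert h using 1
    abel
  refine le_antisymm (key w) ?_
  simpa using key w⁻¹

lemma movedSpace_rootRefl_le {v : V} (hv : ‖v‖ = 1) : movedSpace (rootRefl v) ≤ ℝ ∙ v := by
  intro u hu
  obtain ⟨y, rfl⟩ := mem_movedSpace.mp hu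
  rw [rootRefl_apply hv, sub_sub_cancel_left]
  exact Submodule.neg_mem _ (Submodule.smul_mem _ _ (Submodule.mem_span_singleton_self v))

lemma mem_movedSpace_rootRefl (v : V) : v ∈ movedSpace (rootRefl v) := by
  refine ⟨(-(1 / 2 : ℝ)) • v, ?_⟩
  have h : rootRefl v ((-(1 / 2 : ℝ)) • v) - (-(1 / 2 : ℝ)) • v = v := by
    rw [map_smul, rootRefl_self]
    module
  exact h

lemma movedSpace_rootRefl {v : V} (hv : ‖v‖ = 1) : movedSpace (rootRefl v) = ℝ ∙ v :=
  le_antisymm (movedSpace_rootRefl_le hv)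
    ((Submodule.span_singleton_le_iff_mem _ _).mpr (mem_movedSpace_rootRefl v))

lemma movedSpace_rootRefl_mul_le {v : V} (hv : ‖v‖ = 1) (w : V ≃ₗᵢ[ℝ] V) :
    movedSpace (rootRefl v * w) ≤ (ℝ ∙ v) ⊔ movedSpace w := by
  rw [← movedSpace_rootRefl hv]
  exact movedSpace_mul_le _ _

lemma finrank_movedSpace_mul_le [FiniteDimensional ℝ V] (a b : V ≃ₗᵢ[ℝ] V) :
    Module.finrank ℝ (movedSpace (a * b)) ≤
      Module.finrank ℝ (movedSpace a) + Module.finrank ℝ (movedSpace b) :=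
  (Submodule.finrank_mono (movedSpace_mul_le a b)).trans
    (Submodule.finrank_add_le_finrank_add_finrank _ _)

lemma finrank_movedSpace_rootRefl {v : V} (hv : ‖v‖ = 1) :
    Module.finrank ℝ (movedSpace (rootRefl v)) = 1 := by
  rw [movedSpace_rootRefl hv]
  exact finrank_span_singleton (by rintro rfl; simp at hv)

lemma movedSpace_rootRefl_mul_le_of_mem {v : V} (hv : ‖v‖ = 1) {w : V ≃ₗᵢ[ℝ] V}
    (h : v ∈ movedSpace w) : movedSpace (rootRefl v * w) ≤ movedSpace w :=
  (movedSpace_rootRefl_mul_le hv w).trans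
    (sup_le ((Submodule.span_singleton_le_iff_mem _ _).mpr h) le_rfl)

/-- If `v = w y - y`, then `R(v)` sends `w y` back to `y`, so `R(v) w` gains the fixed vector `y`
and its moved space is strictly smaller. Subadditivity limits the drop to one. -/
lemma finrank_movedSpace_rootRefl_mul_of_mem [FiniteDimensional ℝ V] {v : V}
    (hv : ‖v‖ = 1) {w : V ≃ₗᵢ[ℝ] V} (h : v ∈ movedSpace w) :
    Module.finrank ℝ (movedSpace (rootRefl v * w)) + 1 = Module.finrank ℝ (movedSpace w) := by
  have hv0 : v ≠ 0 := by rintro rfl; simp at hv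
  have hle := movedSpace_rootRefl_mul_le_of_mem hv h
  obtain ⟨y, hy⟩ := mem_movedSpace.mp h
  have hfix : (rootRefl v * w) y = y := by
    rw [isometry_mul_apply, rootRefl, ← hy]
    exact Submodule.reflection_sub (w.norm_map y)
  have hlt : movedSpace (rootRefl v * w) < movedSpace w := by
    refine lt_of_le_of_ne hle fun heq => hv0 ?_
    have : ∀ u ∈ movedSpace w, ⟪u, y⟫_ℝ = 0 := fun u hu =>
      inner_eq_zero_of_mem_movedSpace (heq ▸ hu) hfix
    rw [← hy, sub_eq_zero]
    exact fixed_iff.mpr this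
  have h1 := Submodule.finrank_lt_finrank_of_lt hlt
  have h2 := finrank_movedSpace_mul_le (rootRefl v) (rootRefl v * w)
  rw [rootRefl_mul_cancel_left, finrank_movedSpace_rootRefl hv] at h2
  omega

/-- Some fixed vector of `w` is not orthogonal to `v`, and `R(v) w` moves it along `v`. So `v` lies
in the moved space of `R(v) w`, to which the preceding lemma applies. -/
lemma finrank_movedSpace_rootRefl_mul_of_notMem [FiniteDimensional ℝ V] {v : V}
    (hv : ‖v‖ = 1) {w : V ≃ₗᵢ[ℝ] V} (h : v ∉ movedSpace w) :
    Module.finrank ℝ (movedSpace (rootRefl v * w)) = Module.finrank ℝ (movedSpace w) + 1 := by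
  rw [mem_movedSpace_iff_fixed] at h
  push Not at h
  obtain ⟨y, hy, hvy⟩ := h
  have h1 := sub_mem_movedSpace (rootRefl v * w) y
  rw [isometry_mul_apply, hy, rootRefl_apply hv, sub_sub_cancel_left,
    Submodule.neg_mem_iff, Submodule.smul_mem_iff _ (by simpa using hvy)] at h1
  have h2 := finrank_movedSpace_rootRefl_mul_of_mem hv h1
  rw [rootRefl_mul_cancel_left] at h2
  exact h2.symm

lemma mem_movedSpace_iff_finrank [FiniteDimensional ℝ V] {v : V} (hv : ‖v‖ = 1) {w : V ≃ₗᵢ[ℝ] V} :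
    v ∈ movedSpace w ↔
      Module.finrank ℝ (movedSpace w) = 1 + Module.finrank ℝ (movedSpace (rootRefl v * w)) := by
  by_cases h : v ∈ movedSpace w
  · simp only [h, true_iff]
    rw [← finrank_movedSpace_rootRefl_mul_of_mem hv h, add_comm]
  · simp only [h, false_iff]
    rw [finrank_movedSpace_rootRefl_mul_of_notMem hv h]
    omega

/-- Passing to inverses turns right multiplication by a reflection into left multiplication. -/
lemma movedSpace_mul_rootRefl (w : V ≃ₗᵢ[ℝ] V) (v : V) :
    movedSpace (w * rootRefl v) = movedSpace (rootRefl v * w⁻¹) := by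
  rw [← movedSpace_inv, mul_inv_rev, rootRefl_inv]

end Reflections

/-! ### Products of reflections along a list. -/

section Words

variable {V : Type*} [NormedAddCommGroup V] [InnerProductSpace ℝ V] {ι : Type*}

/-- The product of the reflections in the vectors `α i`, for `i` running through `L`. -/
def word (α : ι → V) (L : List ι) : V ≃ₗᵢ[ℝ] V := (L.map fun i => rootRefl (α i)).prod

@[simp] lemma word_nil (α : ι → V) : word α [] = 1 := rfl

@[simp] lemma word_cons (α : ι → V) (i : ι) (L : List ι) :
    word α (i :: L) = rootRefl (α i) * word α L := by simp [word]

@[simp] lemma word_append (α : ι → V) (L L' : List ι) :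
    word α (L ++ L') = word α L * word α L' := by simp [word]

lemma word_reverse (α : ι → V) (L : List ι) : word α L.reverse = (word α L)⁻¹ := by
  induction L with
  | nil => simp
  | cons i L ih => simp [ih]

lemma movedSpace_word_le {α : ι → V} (hα : ∀ i, ‖α i‖ = 1) (L : List ι) :
    movedSpace (word α L) ≤ Submodule.span ℝ (α '' {i | i ∈ L}) := by
  induction L with
  | nil => simp
  | cons i L ih =>
    rw [word_cons]
    refine (movedSpace_rootRefl_mul_le (hα i) _).trans (sup_le ?_ (ih.trans ?_))
    · rw [Submodule.span_singleton_le_iff_mem]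
      exact Submodule.subset_span ⟨i, by simp, rfl⟩
    · exact Submodule.span_mono (Set.image_mono fun j hj => by simp_all)

/-- Each letter's vector lies outside the span of those after it, so every letter adds one
dimension. -/
lemma finrank_movedSpace_word [FiniteDimensional ℝ V] {α : ι → V} (hα : ∀ i, ‖α i‖ = 1)
    (hli : LinearIndependent ℝ α) {L : List ι} (hL : L.Nodup) :
    Module.finrank ℝ (movedSpace (word α L)) = L.length := by
  induction L with
  | nil => rw [word_nil, movedSpace_one, finrank_bot, List.length_nil]
  | cons i L ih =>
    rw [List.nodup_cons] at hL
    rw [word_cons, finrank_movedSpace_rootRefl_mul_of_notMem (hα i), ih hL.2, List.length_cons]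
    intro h
    exact hli.notMem_span_image (s := {i | i ∈ L}) hL.1 (movedSpace_word_le hα L h)

end Words

/-! ### Simple systems: positivity, exchange, obtuse angles. -/

section SimpleSystem

variable {V : Type*} [NormedAddCommGroup V] [InnerProductSpace ℝ V] {ι : Type*}
  {W : Subgroup (V ≃ₗᵢ[ℝ] V)}

lemma mem_hull_range_iff [Fintype ι] {δ : ι → V} {v : V} :
    v ∈ PointedCone.hull ℝ (Set.range δ) ↔ ∃ c : ι → ℝ, (∀ i, 0 ≤ c i) ∧ ∑ i, c i • δ i = v := by
  rw [Submodule.mem_span_range_iff_exists_fun]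
  constructor
  · rintro ⟨c, rfl⟩
    exact ⟨fun i => c i, fun i => (c i).2, rfl⟩
  · rintro ⟨c, hc, rfl⟩
    exact ⟨fun i => ⟨c i, hc i⟩, rfl⟩

/-- The vector `v` is a nonnegative combination of the basis `b`. -/
def IsNonneg (b : Module.Basis ι ℝ V) (v : V) : Prop := ∀ i, 0 ≤ b.repr v i

lemma mem_hull_basis_iff [Fintype ι] {b : Module.Basis ι ℝ V} {v : V} :
    v ∈ PointedCone.hull ℝ (Set.range b) ↔ IsNonneg b v := by
  rw [mem_hull_range_iff]
  constructor
  · rintro ⟨c, hc, rfl⟩ i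
    rw [b.repr_sum_self]
    exact hc i
  · intro h
    exact ⟨fun i => b.repr v i, h, b.sum_repr v⟩

lemma IsNonneg.eq_zero {b : Module.Basis ι ℝ V} {v : V} (h : IsNonneg b v)
    (h' : IsNonneg b (-v)) : v = 0 := by
  rw [← b.repr.map_eq_zero_iff]
  ext i
  have := h' i
  simp only [map_neg, Finsupp.coe_neg, Pi.neg_apply] at this
  exact le_antisymm (by simpa using this) (h i)

lemma isNonneg_basis (b : Module.Basis ι ℝ V) (i : ι) : IsNonneg b (b i) := by
  classical
  intro j
  rw [b.repr_self, Finsupp.single_apply]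
  split_ifs <;> norm_num

lemma neg_mem_roots {β : V} (h : β ∈ roots W) : -β ∈ roots W :=
  ⟨by rw [norm_neg, h.1], by rw [rootRefl_neg]; exact h.2⟩

lemma apply_mem_roots {w : V ≃ₗᵢ[ℝ] V} (hw : w ∈ W) {β : V} (h : β ∈ roots W) :
    w β ∈ roots W :=
  ⟨by rw [w.norm_map, h.1], by
    rw [← rootRefl_conj h.1]; exact W.mul_mem (W.mul_mem hw h.2) (W.inv_mem hw)⟩

lemma ne_zero_of_mem_roots {β : V} (h : β ∈ roots W) : β ≠ 0 := by
  rintro rfl; simpa using h.1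

lemma IsNonneg.not_neg {b : Module.Basis ι ℝ V} {β : V} (hβ : β ∈ roots W)
    (h : IsNonneg b β) : ¬ IsNonneg b (-β) := fun h' =>
  ne_zero_of_mem_roots hβ (h.eq_zero h')

lemma repr_rootRefl_of_ne {b : Module.Basis ι ℝ V} {i j : ι} (hb : ‖b i‖ = 1) (hij : j ≠ i)
    (v : V) : b.repr (rootRefl (b i) v) j = b.repr v j := by
  rw [rootRefl_apply hb]
  simp [hij.symm]

variable {b : Module.Basis ι ℝ V}

lemma IsSimpleSystem.simple_mem (hs : IsSimpleSystem W (Set.range b)) (i : ι) :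
    b i ∈ roots W := hs.subset_roots ⟨i, rfl⟩

lemma IsSimpleSystem.norm_simple (hs : IsSimpleSystem W (Set.range b)) (i : ι) : ‖b i‖ = 1 :=
  (hs.simple_mem i).1

lemma IsSimpleSystem.word_mem (hs : IsSimpleSystem W (Set.range b)) (L : List ι) :
    word b L ∈ W :=
  W.list_prod_mem fun r hr => by
    obtain ⟨i, -, rfl⟩ := List.mem_map.mp hr
    exact (hs.simple_mem i).2

variable [Fintype ι]

lemma IsSimpleSystem.isNonneg_or (hs : IsSimpleSystem W (Set.range b)) {β : V}
    (hβ : β ∈ roots W) : IsNonneg b β ∨ IsNonneg b (-β) := by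
  simpa only [mem_hull_basis_iff] using hs.same_sign β hβ

lemma mem_posRoots_iff {n : ℕ} [NeZero n] {b : Module.Basis (Fin n) ℝ V} {β : V} :
    β ∈ posRoots b W ↔ β ∈ roots W ∧ IsNonneg b β := by
  rw [← mem_hull_basis_iff]; rfl

/-- A simple reflection makes only its own simple root negative. -/
lemma IsSimpleSystem.eq_simple_of_neg (hs : IsSimpleSystem W (Set.range b)) {β : V}
    (hβ : β ∈ roots W) (hpos : IsNonneg b β) {i : ι} (hneg : IsNonneg b (-(rootRefl (b i) β))) :
    β = b i := by
  -- The reflection changes only the `i`-th coordinate, so every other coordinate of `β` is both `≥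
  -- 0` and `≤ 0`.
  have h0 : ∀ j ≠ i, b.repr β j = 0 := by
    intro j hj
    have h1 := hneg j
    rw [map_neg, Finsupp.coe_neg, Pi.neg_apply, repr_rootRefl_of_ne (hs.norm_simple i) hj] at h1
    exact le_antisymm (by linarith) (hpos j)
  have h1 : β = b.repr β i • b i := by
    conv_lhs => rw [← b.sum_repr β]
    refine Finset.sum_eq_single i (fun j _ hj => ?_) (by simp)
    rw [h0 j hj, zero_smul]
  have h2 : b.repr β i = 1 := by
    have := hβ.1
    rw [h1, norm_smul, hs.norm_simple, mul_one, Real.norm_eq_abs, abs_of_nonneg (hpos i)] at this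
    exact this
  rw [h1, h2, one_smul]

/-- Applying the letters from the right, some letter `i` turns the image of `b k` negative. There
the suffix maps `b k` to `b i`, hence conjugates `R(b k)` to `R(b i)`, and multiplying by `R(b k)`
on the right deletes that letter. -/
lemma IsSimpleSystem.exchange (hs : IsSimpleSystem W (Set.range b)) (k : ι) (L : List ι)
    (h : IsNonneg b (-(word b L (b k)))) :
    ∃ L' : List ι, L'.length + 1 = L.length ∧ word b L * rootRefl (b k) = word b L' := by
  induction L with
  | nil => exact absurd h ((isNonneg_basis b k).not_neg (hs.simple_mem k))
  | cons i L ih =>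
    have hr : word b L (b k) ∈ roots W := apply_mem_roots (hs.word_mem L) (hs.simple_mem k)
    rcases hs.isNonneg_or hr with hp | hn
    · rw [word_cons, isometry_mul_apply] at h
      have h1 := hs.eq_simple_of_neg hr hp h
      have h2 := rootRefl_conj (hs.norm_simple k) (word b L)
      rw [h1] at h2
      refine ⟨L, rfl, ?_⟩
      rw [word_cons, ← h2]
      simp [mul_assoc]
    · obtain ⟨L', hL', he⟩ := ih hn
      exact ⟨i :: L', by simp [hL'], by rw [word_cons, word_cons, mul_assoc, he]⟩

/-- A word which preserves positivity of the simple roots is trivial. -/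
lemma IsSimpleSystem.word_eq_one (hs : IsSimpleSystem W (Set.range b)) (L : List ι)
    (h : ∀ i, IsNonneg b (word b L (b i))) : word b L = 1 := by
  induction hm : L.length using Nat.strong_induction_on generalizing L with
  | _ m ih =>
    rcases List.eq_nil_or_concat L with rfl | ⟨L', k, rfl⟩
    · simp
    -- The last letter negates its own simple root, so the remaining prefix makes `b k` negative and
    -- exchange shortens the word by two.
    · have hk := h k
      rw [List.concat_eq_append, word_append, isometry_mul_apply, word_cons, word_nil, mul_one,
        rootRefl_self, map_neg] at hk
      obtain ⟨L'', hl, he⟩ := hs.exchange k L' hk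
      have he' : word b (L'.concat k) = word b L'' := by
        rw [← he, List.concat_eq_append, word_append, word_cons, word_nil, mul_one]
      rw [he'] at h ⊢
      refine ih _ ?_ L'' h rfl
      rw [← hm, List.length_concat]; omega

/-- Distinct simple roots form an obtuse angle. -/
lemma IsSimpleSystem.inner_simple_nonpos (hs : IsSimpleSystem W (Set.range b)) {i j : ι}
    (hij : i ≠ j) : ⟪b i, b j⟫_ℝ ≤ 0 := by
  have hr : rootRefl (b i) (b j) ∈ roots W :=
    apply_mem_roots (hs.simple_mem i).2 (hs.simple_mem j)
  -- In the positive case the `i`-th coordinate of `R(b i) (b j)`, which is `-2 ⟪b i, b j⟫`, is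
  -- nonnegative.
  rcases hs.isNonneg_or hr with h | h
  · have := h i
    rw [rootRefl_apply (hs.norm_simple i)] at this
    simp [hij.symm] at this
    linarith
  · exact absurd (hs.eq_simple_of_neg (hs.simple_mem j) (isNonneg_basis b j) h)
      (fun h => hij (b.injective h).symm)

end SimpleSystem

/-! ### The cyclic sequence of roots `ρ_j`. -/

section Prefix

variable {V : Type*} [NormedAddCommGroup V] [InnerProductSpace ℝ V]
  {W : Subgroup (V ≃ₗᵢ[ℝ] V)} {n : ℕ} [NeZero n]

lemma prefixProd_eq_word (α : Fin n → V) (j : ℕ) :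
    prefixProd α j = word α ((List.range j).map (Fin.ofNat n)) := by
  simp [prefixProd, word, Function.comp_def]

@[simp] lemma prefixProd_zero (α : Fin n → V) : prefixProd α 0 = 1 := rfl

lemma prefixProd_succ (α : Fin n → V) (j : ℕ) :
    prefixProd α (j + 1) = prefixProd α j * rootRefl (α (Fin.ofNat n j)) := by
  simp [prefixProd, List.range_succ]

lemma prefixProd_add (α : Fin n → V) (j : ℕ) :
    prefixProd α (n + j) = coxeterElt α * prefixProd α j := by
  induction j with
  | zero => simp [coxeterElt]
  | succ j ih =>
    have : Fin.ofNat n (n + j) = Fin.ofNat n j := by ext; simp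
    rw [← add_assoc, prefixProd_succ, prefixProd_succ, ih, this, mul_assoc]

lemma prefixProd_mul_add (α : Fin n → V) (q j : ℕ) :
    prefixProd α (n * q + j) = coxeterElt α ^ q * prefixProd α j := by
  induction q with
  | zero => simp
  | succ q ih => rw [mul_add, mul_one, add_comm (n * q), add_assoc, prefixProd_add, ih, pow_succ',
      mul_assoc]

lemma rho_mul_add (α : Fin n → V) (q j : ℕ) :
    rho α (n * q + j) = (coxeterElt α ^ q) (rho α j) := by
  have : Fin.ofNat n (n * q + j) = Fin.ofNat n j := by ext; simp
  rw [rho, prefixProd_mul_add, this]; rfl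

lemma map_ofNat_range : (List.range n).map (Fin.ofNat n) = List.finRange n := by
  apply List.ext_getElem
  · simp
  · intro i h1 h2
    ext
    simp at h1
    simp [Nat.mod_eq_of_lt h1]

lemma coxeterElt_eq_word (α : Fin n → V) : coxeterElt α = word α (List.finRange n) := by
  rw [coxeterElt, prefixProd_eq_word, map_ofNat_range]

variable {b : Module.Basis (Fin n) ℝ V}

lemma IsSimpleSystem.prefixProd_mem (hs : IsSimpleSystem W (Set.range b)) (j : ℕ) :
    prefixProd b j ∈ W := by
  rw [prefixProd_eq_word]; exact hs.word_mem _

lemma IsSimpleSystem.coxeterElt_mem (hs : IsSimpleSystem W (Set.range b)) :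
    coxeterElt b ∈ W := hs.prefixProd_mem n

lemma IsSimpleSystem.rho_mem (hs : IsSimpleSystem W (Set.range b)) (j : ℕ) :
    rho b j ∈ roots W := apply_mem_roots (hs.prefixProd_mem j) (hs.simple_mem _)

lemma IsSimpleSystem.movedSpace_coxeterElt (hs : IsSimpleSystem W (Set.range b)) :
    movedSpace (coxeterElt b) = ⊤ := by
  have := b.finiteDimensional_of_finite
  apply Submodule.eq_top_of_finrank_eq
  rw [coxeterElt_eq_word, finrank_movedSpace_word hs.norm_simple b.linearIndependent
    (List.nodup_finRange n), List.length_finRange, Module.finrank_eq_card_basis b, Fintype.card_fin]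

lemma IsSimpleSystem.eq_zero_of_coxeterElt_fixed (hs : IsSimpleSystem W (Set.range b)) {x : V}
    (hx : coxeterElt b x = x) : x = 0 := by
  have := fixed_iff.mp hx x (by rw [hs.movedSpace_coxeterElt]; trivial)
  exact inner_self_eq_zero.mp this

/-- Every positive root occurs among the `rho b j`. -/
lemma IsSimpleSystem.exists_rho_eq (hs : IsSimpleSystem W (Set.range b)) (hfin : Finite W)
    {β : V} (hβ : β ∈ roots W) (hpos : IsNonneg b β) : ∃ j, rho b j = β := by
  -- Pulled back by longer and longer prefixes, `β` could turn negative only after becoming the next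
  -- simple root, that is, only if `β` is some `ρ_j`. Otherwise all `γ⁻ᵗ β` are positive; their sum
  -- over a period is fixed by `γ`, hence zero, which is impossible.
  by_contra! hne
  have hmem : ∀ j, (prefixProd b j)⁻¹ β ∈ roots W := fun j =>
    apply_mem_roots (W.inv_mem (hs.prefixProd_mem j)) hβ
  have key : ∀ j, IsNonneg b ((prefixProd b j)⁻¹ β) := by
    intro j
    induction j with
    | zero => simpa using hpos
    | succ j ih =>
      rcases hs.isNonneg_or (hmem (j + 1)) with h | h
      · exact h
      · rw [prefixProd_succ, mul_inv_rev, rootRefl_inv, isometry_mul_apply] at h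
        have h1 := hs.eq_simple_of_neg (hmem j) ih h
        refine absurd ?_ (hne j)
        rw [rho, ← h1]
        exact (prefixProd b j).apply_symm_apply β
  set γ : W := ⟨coxeterElt b, hs.coxeterElt_mem⟩ with hγ
  have hγn : ∀ t, IsNonneg b (((γ ^ t : W) : V ≃ₗᵢ[ℝ] V)⁻¹ β) := by
    intro t
    have := key (n * t + 0)
    rwa [prefixProd_mul_add, prefixProd_zero, mul_one] at this
  have hm : 0 < orderOf γ := orderOf_pos γ
  set m := orderOf γ with hmdef
  set x : V := ∑ t ∈ Finset.range m, ((coxeterElt b)⁻¹ ^ t) β with hx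
  have hpow : (coxeterElt b)⁻¹ ^ m = 1 := by
    have h1 : ((γ ^ m : W) : V ≃ₗᵢ[ℝ] V) = 1 := by rw [hmdef, pow_orderOf_eq_one]; rfl
    rw [inv_pow, inv_eq_one]
    exact h1
  have hfix : (coxeterElt b)⁻¹ x = x := by
    rw [hx, map_sum]
    simp only [← isometry_mul_apply, ← pow_succ']
    have h1 := Finset.sum_range_succ (fun t => ((coxeterElt b)⁻¹ ^ t) β) m
    rw [Finset.sum_range_succ', hpow, pow_zero] at h1
    exact add_right_cancel h1
  have hx0 : x = 0 := by
    apply hs.eq_zero_of_coxeterElt_fixed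
    conv_lhs => rw [← hfix]
    exact (coxeterElt b).apply_symm_apply x
  have hβ0 : IsNonneg b (-β) := by
    intro i
    have h1 : b.repr x i = 0 := by rw [hx0]; simp
    rw [hx, map_sum, Finsupp.finsetSum_apply] at h1
    have h2 := (Finset.sum_eq_zero_iff_of_nonneg (fun t _ => ?_)).mp h1 0 (by simpa using hm)
    · rw [pow_zero] at h2
      have h2 : b.repr β i = 0 := h2
      simp [h2]
    · have := hγn t i
      simpa [hγ] using this
  exact hpos.not_neg hβ hβ0

end Prefix

/-! ### Reflection length as the dimension of the moved space. -/

section Length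

variable {V : Type*} [NormedAddCommGroup V] [InnerProductSpace ℝ V]
  {W : Subgroup (V ≃ₗᵢ[ℝ] V)} {n : ℕ} {b : Module.Basis (Fin n) ℝ V}

/-- Riesz representation; it supplies the interior points of the chamber, the fundamental weights
and the vectors `p`, `q` of the Coxeter plane. -/
lemma exists_inner_basis_eq (b : Module.Basis (Fin n) ℝ V) (c : Fin n → ℝ) :
    ∃ p : V, ∀ i, ⟪p, b i⟫_ℝ = c i := by
  have := b.finiteDimensional_of_finite
  have := FiniteDimensional.complete ℝ V
  refine ⟨(InnerProductSpace.toDual ℝ V).symm (LinearMap.toContinuousLinearMap (b.constr ℝ c)),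
    fun i => ?_⟩
  rw [InnerProductSpace.toDual_symm_apply]
  simp

lemma inner_eq_sum_repr (b : Module.Basis (Fin n) ℝ V) (v y : V) :
    ⟪v, y⟫_ℝ = ∑ i, b.repr v i * ⟪b i, y⟫_ℝ := by
  conv_lhs => rw [← b.sum_repr v, sum_inner]
  simp [real_inner_smul_left]

lemma IsNonneg.inner_nonneg {v y : V} (hv : IsNonneg b v) (hy : ∀ i, 0 ≤ ⟪b i, y⟫_ℝ) :
    0 ≤ ⟪v, y⟫_ℝ := by
  rw [inner_eq_sum_repr b]
  exact Finset.sum_nonneg fun i _ => mul_nonneg (hv i) (hy i)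

lemma IsNonneg.inner_pos {v y : V} (hv : IsNonneg b v) (hv0 : v ≠ 0)
    (hy : ∀ i, 0 < ⟪b i, y⟫_ℝ) : 0 < ⟪v, y⟫_ℝ := by
  refine lt_of_le_of_ne (hv.inner_nonneg fun i => (hy i).le) fun h => hv0 ?_
  rw [inner_eq_sum_repr b, eq_comm,
    Finset.sum_eq_zero_iff_of_nonneg fun i _ => mul_nonneg (hv i) (hy i).le] at h
  rw [← b.sum_repr v]
  refine Finset.sum_eq_zero fun i hi => ?_
  rw [(mul_eq_zero.mp (h i hi)).resolve_right (hy i).ne', zero_smul]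

/-- Every orbit of `W` meets the closed fundamental chamber. -/
lemma IsSimpleSystem.exists_dominant (hs : IsSimpleSystem W (Set.range b)) (hfin : Finite W)
    (x : V) : ∃ w ∈ W, ∀ i, 0 ≤ ⟪b i, w x⟫_ℝ := by
  obtain ⟨p, hp⟩ := exists_inner_basis_eq b fun _ => 1
  -- As `⟪p, b i⟫ = 1`, applying `R(b i)` changes `⟪p, w x⟫` by `-2 ⟪b i, w x⟫`, which cannot be
  -- positive at a maximum.
  obtain ⟨w, hw⟩ := Finite.exists_max fun w : W => ⟪p, (w : V ≃ₗᵢ[ℝ] V) x⟫_ℝ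
  refine ⟨w, w.2, fun i => ?_⟩
  have h := hw (⟨rootRefl (b i), (hs.simple_mem i).2⟩ * w)
  have h1 : ⟪p, (rootRefl (b i)) ((w : V ≃ₗᵢ[ℝ] V) x)⟫_ℝ ≤ ⟪p, (w : V ≃ₗᵢ[ℝ] V) x⟫_ℝ := h
  rw [rootRefl_apply (hs.norm_simple i), inner_sub_right, real_inner_smul_right, hp] at h1
  linarith

variable [NeZero n]

lemma IsSimpleSystem.exists_word_of_root (hs : IsSimpleSystem W (Set.range b)) (hfin : Finite W)
    {β : V} (hβ : β ∈ roots W) : ∃ L i, rootRefl β = rootRefl (word b L (b i)) := by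
  rcases hs.isNonneg_or hβ with h | h
  · obtain ⟨j, rfl⟩ := hs.exists_rho_eq hfin hβ h
    exact ⟨_, _, by rw [rho, prefixProd_eq_word]⟩
  · obtain ⟨j, hj⟩ := hs.exists_rho_eq hfin (neg_mem_roots hβ) h
    exact ⟨_, _, by rw [← rootRefl_neg, ← hj, rho, prefixProd_eq_word]⟩

/-- `W` is generated by the simple reflections. -/
lemma IsSimpleSystem.exists_word (hs : IsSimpleSystem W (Set.range b)) (hfin : Finite W)
    (hgen : Subgroup.closure (reflections W) = W) {w : V ≃ₗᵢ[ℝ] V} (hw : w ∈ W) :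
    ∃ L, word b L = w := by
  rw [← hgen] at hw
  induction hw using Subgroup.closure_induction with
  | mem w h =>
    obtain ⟨hw, v, hv, rfl⟩ := h
    obtain ⟨L, i, h⟩ := hs.exists_word_of_root hfin ⟨hv, hw⟩
    refine ⟨L ++ i :: L.reverse, ?_⟩
    rw [h, ← rootRefl_conj (hs.norm_simple i), word_append, word_cons, word_reverse, mul_assoc]
  | one => exact ⟨[], rfl⟩
  | mul x y _ _ hx hy =>
    obtain ⟨L, rfl⟩ := hx
    obtain ⟨L', rfl⟩ := hy
    exact ⟨L ++ L', word_append _ _ _⟩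
  | inv x _ hx =>
    obtain ⟨L, rfl⟩ := hx
    exact ⟨L.reverse, word_reverse _ _⟩

lemma IsSimpleSystem.finite_roots (hs : IsSimpleSystem W (Set.range b)) (hfin : Finite W) :
    (roots W).Finite := by
  have h1 : (Set.range fun p : W × Fin n => (p.1 : V ≃ₗᵢ[ℝ] V) (b p.2)).Finite :=
    Set.finite_range _
  refine (h1.union (h1.image Neg.neg)).subset fun β hβ => ?_
  rcases hs.isNonneg_or hβ with h | h
  · obtain ⟨j, hj⟩ := hs.exists_rho_eq hfin hβ h
    exact Or.inl ⟨(⟨_, hs.prefixProd_mem j⟩, _), hj⟩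
  · obtain ⟨j, hj⟩ := hs.exists_rho_eq hfin (neg_mem_roots hβ) h
    exact Or.inr ⟨-β, ⟨(⟨_, hs.prefixProd_mem j⟩, _), hj⟩, neg_neg β⟩

/-- An element of `W` which fixes a regular point is trivial. -/
lemma IsSimpleSystem.eq_one_of_fixed_regular (hs : IsSimpleSystem W (Set.range b))
    (hfin : Finite W) (hgen : Subgroup.closure (reflections W) = W) {w : V ≃ₗᵢ[ℝ] V} (hw : w ∈ W)
    {x : V} (hx : w x = x) (hreg : ∀ β ∈ roots W, ⟪β, x⟫_ℝ ≠ 0) : w = 1 := by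
  -- Regularity puts `g x` in the open chamber. The conjugate of `w` fixes it, so it keeps the
  -- pairing of every simple root with `g x` positive and is trivial by `word_eq_one`.
  obtain ⟨g, hg, hdom⟩ := hs.exists_dominant hfin x
  obtain ⟨L, hL⟩ := hs.exists_word hfin hgen (W.mul_mem (W.mul_mem hg hw) (W.inv_mem hg))
  have hginv : g⁻¹ (g x) = x := g.symm_apply_apply x
  have hfix : word b L (g x) = g x := by
    rw [hL, isometry_mul_apply, isometry_mul_apply, hginv, hx]
  have hpos : ∀ i, 0 < ⟪b i, g x⟫_ℝ := by
    intro i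
    refine lt_of_le_of_ne (hdom i) fun h => ?_
    refine hreg _ (apply_mem_roots (W.inv_mem hg) (hs.simple_mem i)) ?_
    rw [← g.inner_map_map, h]
    congr 1
    exact g.apply_symm_apply (b i)
  have h1 : word b L = 1 := by
    refine hs.word_eq_one L fun i => ?_
    rcases hs.isNonneg_or (apply_mem_roots (hs.word_mem L) (hs.simple_mem i)) with h | h
    · exact h
    · have h2 := h.inner_nonneg hdom
      have h3 := (word b L).inner_map_map (b i) (g x)
      rw [hfix] at h3
      rw [inner_neg_left, h3] at h2
      linarith [hpos i]
  rw [h1] at hL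
  have : w = g⁻¹ * (g * w * g⁻¹) * g := by group
  rw [this, ← hL]
  group

/-- The moved space of a nontrivial element of `W` contains a root. -/
lemma IsSimpleSystem.exists_root_mem_movedSpace (hs : IsSimpleSystem W (Set.range b))
    (hfin : Finite W) (hgen : Subgroup.closure (reflections W) = W) {w : V ≃ₗᵢ[ℝ] V} (hw : w ∈ W)
    (hne : w ≠ 1) : ∃ β ∈ roots W, β ∈ movedSpace w := by
  have := b.finiteDimensional_of_finite
  by_contra! hno
  have : Finite (roots W) := hs.finite_roots hfin
  -- If no root lies in `M(w)`, each root cuts a proper subspace out of the fixed space `F`.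
  -- Finitely many such subspaces do not cover `F`, so `w` fixes a regular vector.
  let F : Submodule ℝ V := LinearMap.ker ((w.toLinearEquiv : V →ₗ[ℝ] V) - LinearMap.id)
  have hF : ∀ x, x ∈ F ↔ w x = x := fun x => by
    rw [LinearMap.mem_ker]; exact sub_eq_zero
  let p : roots W → Submodule ℝ F := fun β => LinearMap.ker ((innerₛₗ ℝ (β : V)) ∘ₗ F.subtype)
  have hp : ¬ (⋃ β, (p β : Set F)) = Set.univ := by
    intro h
    obtain ⟨β, hβ⟩ := Subspace.exists_eq_top_of_iUnion_eq_univ h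
    refine hno β β.2 (mem_movedSpace_iff_fixed.mpr fun x hx => ?_)
    have : (⟨x, (hF x).mpr hx⟩ : F) ∈ p β := by rw [hβ]; trivial
    exact this
  obtain ⟨x, hx⟩ := (Set.ne_univ_iff_exists_notMem _).mp hp
  refine hne (hs.eq_one_of_fixed_regular hfin hgen hw ((hF x).mp x.2) fun β hβ h => hx ?_)
  exact Set.mem_iUnion.mpr ⟨⟨β, hβ⟩, h⟩

lemma finrank_movedSpace_list_prod_le [FiniteDimensional ℝ V] (L : List (V ≃ₗᵢ[ℝ] V))
    (hL : ∀ r ∈ L, r ∈ reflections W) : Module.finrank ℝ (movedSpace L.prod) ≤ L.length := by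
  induction L with
  | nil => rw [List.prod_nil, movedSpace_one, finrank_bot]; exact Nat.zero_le _
  | cons r L ih =>
    obtain ⟨-, v, hv, rfl⟩ := hL r (by simp)
    have h1 := ih fun r hr => hL r (by simp [hr])
    have h2 := finrank_movedSpace_mul_le (rootRefl v) L.prod
    rw [finrank_movedSpace_rootRefl hv] at h2
    rw [List.prod_cons, List.length_cons]
    omega

/-- Peeling off a root of the moved space lowers the dimension by exactly one and stays inside the
moved space. -/
lemma IsSimpleSystem.exists_root_list (hs : IsSimpleSystem W (Set.range b))
    (hfin : Finite W) (hgen : Subgroup.closure (reflections W) = W) (w : V ≃ₗᵢ[ℝ] V) (hw : w ∈ W) :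
    ∃ L : List V, (∀ β ∈ L, β ∈ roots W ∧ β ∈ movedSpace w) ∧
      L.length = Module.finrank ℝ (movedSpace w) ∧ (L.map rootRefl).prod = w := by
  have := b.finiteDimensional_of_finite
  induction hm : Module.finrank ℝ (movedSpace w) using Nat.strong_induction_on generalizing w with
  | _ m ih =>
    by_cases hne : w = 1
    · subst hne
      rw [movedSpace_one, finrank_bot] at hm
      exact ⟨[], by simp, by simp [hm], rfl⟩
    · obtain ⟨β, hβ, hβw⟩ := hs.exists_root_mem_movedSpace hfin hgen hw hne
      have h1 := finrank_movedSpace_rootRefl_mul_of_mem hβ.1 hβw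
      obtain ⟨L, hL, hlen, hprod⟩ := ih _ (by omega) _ (W.mul_mem hβ.2 hw) rfl
      refine ⟨β :: L, ?_, ?_, ?_⟩
      · intro δ hδ
        rcases List.mem_cons.mp hδ with rfl | hδ
        · exact ⟨hβ, hβw⟩
        · exact ⟨(hL δ hδ).1, movedSpace_rootRefl_mul_le_of_mem hβ.1 hβw (hL δ hδ).2⟩
      · rw [List.length_cons, hlen]; omega
      · rw [List.map_cons, List.prod_cons, hprod, rootRefl_mul_cancel_left]

/-- Carter's lemma: the reflection length is the dimension of the moved space. -/
lemma IsSimpleSystem.reflLength_eq (hs : IsSimpleSystem W (Set.range b))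
    (hfin : Finite W) (hgen : Subgroup.closure (reflections W) = W) {w : V ≃ₗᵢ[ℝ] V} (hw : w ∈ W) :
    reflLength W w = Module.finrank ℝ (movedSpace w) := by
  have := b.finiteDimensional_of_finite
  obtain ⟨L, hL, hlen, hprod⟩ := hs.exists_root_list hfin hgen w hw
  have hmem : Module.finrank ℝ (movedSpace w) ∈ {k | ∃ L : List (V ≃ₗᵢ[ℝ] V),
      (∀ r ∈ L, r ∈ reflections W) ∧ L.length = k ∧ L.prod = w} := by
    refine ⟨L.map rootRefl, fun r hr => ?_, by simp [hlen], hprod⟩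
    obtain ⟨β, hβ, rfl⟩ := List.mem_map.mp hr
    exact ⟨(hL β hβ).1.2, β, (hL β hβ).1.1, rfl⟩
  refine le_antisymm (Nat.sInf_le hmem) ?_
  refine le_csInf ⟨_, hmem⟩ ?_
  rintro k ⟨L', hL', rfl, rfl⟩
  exact finrank_movedSpace_list_prod_le L' hL'

/-- By Carter's lemma both sides say that multiplying `σ` by `R(β)` lowers the dimension of the
moved space by one. -/
lemma IsSimpleSystem.absLE_rootRefl_iff (hs : IsSimpleSystem W (Set.range b))
    (hfin : Finite W) (hgen : Subgroup.closure (reflections W) = W) {σ : V ≃ₗᵢ[ℝ] V} (hσ : σ ∈ W)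
    {β : V} (hβ : β ∈ roots W) : absLE W (rootRefl β) σ ↔ β ∈ movedSpace σ := by
  have := b.finiteDimensional_of_finite
  rw [absLE, hs.reflLength_eq hfin hgen hσ, hs.reflLength_eq hfin hgen hβ.2, rootRefl_inv,
    hs.reflLength_eq hfin hgen (W.mul_mem hβ.2 hσ), finrank_movedSpace_rootRefl hβ.1,
    mem_movedSpace_iff_finrank hβ.1]

lemma IsSimpleSystem.posRootsBelow_eq (hs : IsSimpleSystem W (Set.range b))
    (hfin : Finite W) (hgen : Subgroup.closure (reflections W) = W) {σ : V ≃ₗᵢ[ℝ] V}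
    (hσ : σ ∈ W) :
    posRootsBelow b W σ = {β | β ∈ posRoots b W ∧ β ∈ movedSpace σ} := by
  ext β
  exact and_congr_right fun hβ => hs.absLE_rootRefl_iff hfin hgen hσ hβ.1

lemma roots_movedSubgroup (U : Submodule ℝ V) :
    roots (movedSubgroup W U) = {β | β ∈ roots W ∧ β ∈ U} := by
  ext β
  constructor
  · rintro ⟨h1, h2, h3⟩
    exact ⟨⟨h1, h2⟩, h3 (mem_movedSpace_rootRefl β)⟩
  · rintro ⟨⟨h1, h2⟩, h3⟩
    refine ⟨h1, h2, ?_⟩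
    rw [movedSpace_rootRefl h1]
    exact (Submodule.span_singleton_le_iff_mem _ _).mpr h3

end Length

/-! ### A positive eigenvector of the Gram matrix. -/

section Perron

variable {V : Type*} [NormedAddCommGroup V] [InnerProductSpace ℝ V] {n : ℕ}

lemma inner_sum_smul_sum_smul (b : Fin n → V) (x y : Fin n → ℝ) :
    ⟪∑ i, x i • b i, ∑ j, y j • b j⟫_ℝ = ∑ i, ∑ j, x i * y j * ⟪b i, b j⟫_ℝ := by
  rw [sum_inner]
  refine Finset.sum_congr rfl fun i _ => ?_
  rw [inner_sum]
  refine Finset.sum_congr rfl fun j _ => ?_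
  rw [real_inner_smul_left, real_inner_smul_right]
  ring

variable [NeZero n]

/-- For vectors which are pairwise at obtuse angles, the Gram matrix has a nonnegative
eigenvector. -/
lemma exists_nonneg_gram_eigenvector (b : Fin n → V)
    (hobt : ∀ i j, i ≠ j → ⟪b i, b j⟫_ℝ ≤ 0) [FiniteDimensional ℝ V] :
    ∃ (c : Fin n → ℝ) (μ : ℝ), (∀ i, 0 ≤ c i) ∧ c ≠ 0 ∧
      ∀ i, ⟪∑ j, c j • b j, b i⟫_ℝ = μ * c i := by
  have := FiniteDimensional.complete ℝ V
  let T₀ : EuclideanSpace ℝ (Fin n) →ₗ[ℝ] V :=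
    (Fintype.linearCombination ℝ b) ∘ₗ (WithLp.linearEquiv 2 ℝ (Fin n → ℝ)).toLinearMap
  let T : EuclideanSpace ℝ (Fin n) →L[ℝ] V := LinearMap.toContinuousLinearMap T₀
  have hT : ∀ x, T x = ∑ i, x i • b i := fun x => by
    simp [T, T₀, Fintype.linearCombination_apply]
  let S := (ContinuousLinearMap.adjoint T) ∘L T
  have hS : ∀ x y, ⟪S x, y⟫_ℝ = ⟪T x, T y⟫_ℝ := fun x y => by
    simp [S, ContinuousLinearMap.adjoint_inner_left]
  have hSa : IsSelfAdjoint S := by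
    rw [ContinuousLinearMap.isSelfAdjoint_iff_isSymmetric]
    intro x y
    have h1 := hS x y
    have h2 := hS y x
    rw [real_inner_comm, real_inner_comm (T x)] at h2
    exact h1.trans h2.symm
  have hre : ∀ x, S.reApplyInnerSelf x = ⟪T x, T x⟫_ℝ := fun x => by
    rw [ContinuousLinearMap.reApplyInnerSelf_apply, hS]; rfl
  -- A minimiser of `‖∑ x i • b i‖²` on the unit sphere is an eigenvector. Off-diagonal Gram entries
  -- are `≤ 0`, so replacing the coordinates by absolute values gives another minimiser.
  obtain ⟨x, hx, hmin⟩ := (isCompact_sphere (0 : EuclideanSpace ℝ (Fin n)) 1).exists_isMinOn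
    (NormedSpace.sphere_nonempty.mpr zero_le_one)
    (f := S.reApplyInnerSelf) (S.reApplyInnerSelf_continuous.continuousOn)
  let y : EuclideanSpace ℝ (Fin n) := WithLp.toLp 2 fun i => |x i|
  have hy : ‖y‖ = 1 := by
    have : ‖y‖ = ‖x‖ := by simp [EuclideanSpace.norm_eq, y]
    rw [this]; simpa using hx
  have hle : S.reApplyInnerSelf y ≤ S.reApplyInnerSelf x := by
    rw [hre, hre, hT, hT, inner_sum_smul_sum_smul, inner_sum_smul_sum_smul]
    refine Finset.sum_le_sum fun i _ => Finset.sum_le_sum fun j _ => ?_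
    by_cases hij : i = j
    · subst hij
      simp [y]
    · refine mul_le_mul_of_nonpos_right ?_ (hobt i j hij)
      rw [show y i * y j = |x i * x j| from (abs_mul _ _).symm]
      exact le_abs_self _
  have hymin : IsMinOn S.reApplyInnerSelf (Metric.sphere 0 ‖y‖) y := by
    rw [hy]
    exact fun z hz => hle.trans (hmin hz)
  have hy0 : y ≠ 0 := by rintro h; rw [h] at hy; simp at hy
  obtain ⟨μ, hμ⟩ : ∃ μ : ℝ, S y = μ • y :=
    ⟨_, (hSa.hasEigenvector_of_isMinOn hy0 hymin).apply_eq_smul⟩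
  refine ⟨fun i => y i, μ, fun i => abs_nonneg _, fun h => hy0 ?_, fun i => ?_⟩
  · ext i; exact congrFun h i
  · have h2 := hS y (EuclideanSpace.single i 1)
    have h3 : T (EuclideanSpace.single i 1) = b i := by
      rw [hT, Finset.sum_eq_single i] <;> simp +contextual
    rw [h3, hT] at h2
    rw [← h2]
    rw [hμ, real_inner_smul_left]
    simp [EuclideanSpace.inner_single_right]

variable {W : Subgroup (V ≃ₗᵢ[ℝ] V)} {b : Module.Basis (Fin n) ℝ V}

/-- The Perron-Frobenius eigenvector of the Gram matrix of a simple system. -/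
lemma IsSimpleSystem.exists_perron (hs : IsSimpleSystem W (Set.range b))
    (hW : IsFiniteIrreducibleReflectionGroup W) :
    ∃ (c : Fin n → ℝ) (l : ℝ), (∀ i, 0 < c i) ∧ 0 ≤ l ∧ l < 1 ∧
      ∀ i, ⟪∑ j, c j • b j, b i⟫_ℝ = (1 - l) * c i := by
  have := b.finiteDimensional_of_finite
  obtain ⟨c, μ, hc, hc0, hev⟩ := exists_nonneg_gram_eigenvector b
    fun i j hij => hs.inner_simple_nonpos hij
  obtain ⟨k, hk⟩ := Function.ne_iff.mp hc0
  have hterm : ∀ i j, j ≠ i → c j * ⟪b j, b i⟫_ℝ ≤ 0 := fun i j hj =>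
    mul_nonpos_of_nonneg_of_nonpos (hc j) (hs.inner_simple_nonpos hj)
  have hexp : ∀ i, ⟪∑ j, c j • b j, b i⟫_ℝ = c i + ∑ j ∈ Finset.univ.erase i, c j * ⟪b j, b i⟫_ℝ := by
    intro i
    rw [sum_inner, ← Finset.add_sum_erase _ _ (Finset.mem_univ i)]
    simp [real_inner_smul_left, hs.norm_simple i]
  have hzero : ∀ i j, c i = 0 → c j ≠ 0 → ⟪b j, b i⟫_ℝ = 0 := by
    intro i j hi hj
    have h1 := hexp i
    rw [hev i, hi, mul_zero, zero_add, eq_comm, Finset.sum_eq_zero_iff_of_nonpos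
      fun j hj => hterm i j (Finset.ne_of_mem_erase hj)] at h1
    have hji : j ≠ i := by rintro rfl; exact hj hi
    exact (mul_eq_zero.mp (h1 j (Finset.mem_erase.mpr ⟨hji, Finset.mem_univ j⟩))).resolve_left hj
  -- Simple roots off the support of `c` are orthogonal to those on it (`hzero`), so the span of the
  -- support is `W`-invariant and irreducibility makes the support everything.
  let U : Submodule ℝ V := Submodule.span ℝ (b '' {j | c j ≠ 0})
  have horth : ∀ i, c i = 0 → ∀ x ∈ U, ⟪b i, x⟫_ℝ = 0 := by
    intro i hi x hx
    refine Submodule.span_induction (p := fun x _ => ⟪b i, x⟫_ℝ = 0) ?_ ?_ ?_ ?_ hx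
    · rintro _ ⟨j, hj, rfl⟩
      rw [real_inner_comm]; exact hzero i j hi hj
    · exact inner_zero_right _
    · intro x y _ _ hx hy
      rw [inner_add_right, hx, hy, add_zero]
    · intro a x _ hx
      rw [real_inner_smul_right, hx, mul_zero]
  have hrefl : ∀ i, ∀ x ∈ U, rootRefl (b i) x ∈ U := by
    intro i x hx
    rw [rootRefl_apply (hs.norm_simple i)]
    by_cases hi : c i = 0
    · rw [horth i hi x hx]; simpa using hx
    · exact U.sub_mem hx (U.smul_mem _ (Submodule.subset_span ⟨i, hi, rfl⟩))
  have hword : ∀ L : List (Fin n), ∀ x ∈ U, word b L x ∈ U := by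
    intro L
    induction L with
    | nil => intro x hx; exact hx
    | cons i L ih => intro x hx; rw [word_cons]; exact hrefl i _ (ih x hx)
  have hpos : ∀ i, 0 < c i := by
    intro i
    refine lt_of_le_of_ne (hc i) fun hi => ?_
    have hne : b i ≠ 0 := b.ne_zero i
    rcases hW.irreducible U fun w hw x hx => by
      obtain ⟨L, rfl⟩ := hs.exists_word hW.finite hW.generated hw
      exact hword L x hx with h | h
    · have : b k ∈ U := Submodule.subset_span ⟨k, hk, rfl⟩
      rw [h, Submodule.mem_bot] at this
      exact b.ne_zero k this
    · exact hne (inner_self_eq_zero.mp (horth i hi.symm (b i) (by rw [h]; trivial)))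
  -- The eigenvalue is at most 1 because the off-diagonal terms are `≤ 0`, and positive because the
  -- `b i` are independent. Hence `l = 1 - μ` is the cosine of an angle in `(0, π / 2]`.
  refine ⟨c, 1 - μ, hpos, ?_, ?_, fun i => by rw [hev i]; ring⟩
  · have h1 := hexp k
    rw [hev k] at h1
    have h2 : ∑ j ∈ Finset.univ.erase k, c j * ⟪b j, b k⟫_ℝ ≤ 0 :=
      Finset.sum_nonpos fun j hj => hterm k j (Finset.ne_of_mem_erase hj)
    nlinarith [hpos k]
  · set u := ∑ j, c j • b j with hu
    have hu0 : u ≠ 0 := by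
      intro h
      have := b.repr_sum_self c
      rw [← hu, h] at this
      exact hc0 (by rw [← this]; simp)
    have h1 : ⟪u, u⟫_ℝ = μ * ∑ i, c i ^ 2 := by
      conv_lhs => rw [hu, sum_inner]
      rw [Finset.mul_sum]
      refine Finset.sum_congr rfl fun i _ => ?_
      rw [real_inner_smul_left, real_inner_comm, hev i]
      ring
    have h2 : 0 < ⟪u, u⟫_ℝ := real_inner_self_pos.mpr hu0
    have h3 : 0 ≤ ∑ i, c i ^ 2 := Finset.sum_nonneg fun i _ => sq_nonneg _
    have : 0 < μ := by
      by_contra! hμ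
      nlinarith
    linarith

end Perron

/-! ### The action of a bipartite Coxeter element on the Coxeter plane. -/

section Bipartite

variable {V : Type*} [NormedAddCommGroup V] [InnerProductSpace ℝ V]

lemma ext_inner_basis {ι : Type*} (b : Module.Basis ι ℝ V) {x y : V}
    (h : ∀ i, ⟪x, b i⟫_ℝ = ⟪y, b i⟫_ℝ) : x = y :=
  _root_.InnerProductSpace.ext_inner_right_basis b h

lemma word_apply_of_orthogonal {ι : Type*} [DecidableEq ι] {α : ι → V} (hα : ∀ i, ‖α i‖ = 1)
    {L : List ι} (hL : L.Nodup) (hort : ∀ i ∈ L, ∀ j ∈ L, i ≠ j → ⟪α i, α j⟫_ℝ = 0) (x : V) :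
    word α L x = x - (2 : ℝ) • ∑ i ∈ L.toFinset, ⟪α i, x⟫_ℝ • α i := by
  induction L with
  | nil => simp
  | cons i L ih =>
    rw [List.nodup_cons] at hL
    have h1 : ⟪α i, ∑ j ∈ L.toFinset, ⟪α j, x⟫_ℝ • α j⟫_ℝ = 0 := by
      rw [inner_sum]
      refine Finset.sum_eq_zero fun j hj => ?_
      have hj' : j ∈ L := by simpa using hj
      rw [real_inner_smul_right, hort i (by simp) j (by simp [hj']) (by rintro rfl; exact hL.1 hj'),
        mul_zero]
    rw [word_cons, isometry_mul_apply,
      ih hL.2 fun j hj k hk => hort j (by simp [hj]) k (by simp [hk]), List.toFinset_cons,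
      Finset.sum_insert (by simpa using hL.1), rootRefl_apply (hα i), inner_sub_right,
      real_inner_smul_right, h1]
    module

lemma word_apply_eq_self {ι : Type*} {α : ι → V} (hα : ∀ i, ‖α i‖ = 1)
    {L : List ι} {x : V} (hort : ∀ i ∈ L, ⟪α i, x⟫_ℝ = 0) : word α L x = x := by
  induction L with
  | nil => rfl
  | cons i L ih =>
    rw [word_cons, isometry_mul_apply, ih fun j hj => hort j (by simp [hj]), rootRefl_apply (hα i),
      hort i (by simp)]
    simp

lemma word_mul_self_of_orthogonal {ι : Type*} [DecidableEq ι] {α : ι → V} (hα : ∀ i, ‖α i‖ = 1)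
    {L : List ι} (hL : L.Nodup) (hort : ∀ i ∈ L, ∀ j ∈ L, i ≠ j → ⟪α i, α j⟫_ℝ = 0) :
    word α L * word α L = 1 := by
  have : word α L = word α L.reverse := by
    ext x
    rw [word_apply_of_orthogonal hα hL hort, word_apply_of_orthogonal hα (List.nodup_reverse.mpr hL)
      (by simpa using hort), List.toFinset_reverse]
  nth_rewrite 1 [this]
  rw [word_reverse, inv_mul_cancel]

lemma finrank_movedSpace_conj [FiniteDimensional ℝ V] (x w : V ≃ₗᵢ[ℝ] V) :
    Module.finrank ℝ (movedSpace (x * w * x⁻¹)) = Module.finrank ℝ (movedSpace w) := by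
  have : movedSpace (x * w * x⁻¹) = (movedSpace w).map (x.toLinearEquiv : V →ₗ[ℝ] V) := by
    ext u
    simp only [mem_movedSpace, Submodule.mem_map]
    constructor
    · rintro ⟨y, rfl⟩
      refine ⟨_, ⟨x⁻¹ y, rfl⟩, ?_⟩
      have : x (x⁻¹ y) = y := x.apply_symm_apply y
      change x (w (x⁻¹ y) - x⁻¹ y) = x (w (x⁻¹ y)) - y
      rw [map_sub, this]
    · rintro ⟨_, ⟨y, rfl⟩, rfl⟩
      refine ⟨x y, ?_⟩
      have : x⁻¹ (x y) = y := x.symm_apply_apply y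
      change x (w (x⁻¹ (x y))) - x y = x (w y - y)
      rw [map_sub, this]
  rw [this]
  exact LinearEquiv.finrank_map_eq x.toLinearEquiv _

variable {n : ℕ}

/-- A Perron-Frobenius eigenvector `c` of the Gram matrix of a bipartite simple system, together
with the vectors `p` and `q` which are dual to its two halves. -/
structure IsPerronPair (b : Module.Basis (Fin n) ℝ V) (s : ℕ) (c : Fin n → ℝ) (θ : ℝ)
    (p q : V) : Prop where
  norm_eq : ∀ i, ‖b i‖ = 1
  le : s ≤ n
  orth₁ : ∀ i j : Fin n, i ≠ j → (i : ℕ) < s → (j : ℕ) < s → ⟪b i, b j⟫_ℝ = 0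
  orth₂ : ∀ i j : Fin n, i ≠ j → s ≤ (i : ℕ) → s ≤ (j : ℕ) → ⟪b i, b j⟫_ℝ = 0
  pos : ∀ i, 0 < c i
  eig : ∀ i, ⟪∑ j, c j • b j, b i⟫_ℝ = (1 - Real.cos θ) * c i
  theta_pos : 0 < θ
  theta_le : θ ≤ Real.pi / 2
  inner_p : ∀ i, ⟪p, b i⟫_ℝ = if (i : ℕ) < s then c i else 0
  inner_q : ∀ i, ⟪q, b i⟫_ℝ = if (i : ℕ) < s then 0 else c i

variable {b : Module.Basis (Fin n) ℝ V} {s : ℕ} {c : Fin n → ℝ} {θ : ℝ} {p q : V}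

lemma IsPerronPair.sin_pos (h : IsPerronPair b s c θ p q) : 0 < Real.sin θ :=
  Real.sin_pos_of_pos_of_lt_pi h.theta_pos (by linarith [h.theta_le, Real.pi_pos])

lemma IsPerronPair.inner_sum_of_orth (h : IsPerronPair b s c θ p q) (F : Finset (Fin n)) (i : Fin n)
    (hi : i ∈ F) (hort : ∀ j ∈ F, j ≠ i → ⟪b j, b i⟫_ℝ = 0) :
    ⟪∑ j ∈ F, c j • b j, b i⟫_ℝ = c i := by
  rw [sum_inner, Finset.sum_eq_single i]
  · rw [real_inner_smul_left, real_inner_self_eq_norm_sq, h.norm_eq]; ring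
  · intro j hj hji
    rw [real_inner_smul_left, hort j hj hji, mul_zero]
  · exact fun h => absurd hi h

variable [NeZero n]

/-- The indices below `s`. -/
def lowerList (n s : ℕ) [NeZero n] : List (Fin n) := (List.range s).map (Fin.ofNat n)

/-- The `k` indices following `s`. -/
def upperList (n s k : ℕ) [NeZero n] : List (Fin n) :=
  (List.range k).map fun m => Fin.ofNat n (s + m)

lemma mem_lowerList {s : ℕ} (hs : s ≤ n) {i : Fin n} : i ∈ lowerList n s ↔ (i : ℕ) < s := by
  simp only [lowerList, List.mem_map, List.mem_range]
  constructor
  · rintro ⟨a, ha, rfl⟩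
    simpa [Nat.mod_eq_of_lt (ha.trans_le hs)] using ha
  · intro h
    exact ⟨i, h, by ext; simp⟩

lemma mem_upperList {s k : ℕ} (hs : s + k ≤ n) {i : Fin n} :
    i ∈ upperList n s k ↔ s ≤ (i : ℕ) ∧ (i : ℕ) < s + k := by
  simp only [upperList, List.mem_map, List.mem_range]
  constructor
  · rintro ⟨a, ha, rfl⟩
    have : s + a < n := by omega
    simp only [Fin.val_ofNat, Nat.mod_eq_of_lt this]
    omega
  · rintro ⟨h1, h2⟩
    exact ⟨i - s, by omega, by ext; simp [Nat.add_sub_cancel' h1]⟩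

lemma nodup_lowerList {s : ℕ} (hs : s ≤ n) : (lowerList n s).Nodup := by
  refine List.Nodup.map_on (fun x hx y hy h => ?_) List.nodup_range
  have := congrArg Fin.val h
  rw [List.mem_range] at hx hy
  simpa [Nat.mod_eq_of_lt (hx.trans_le hs), Nat.mod_eq_of_lt (hy.trans_le hs)] using this

lemma nodup_upperList {s k : ℕ} (hs : s + k ≤ n) : (upperList n s k).Nodup := by
  refine List.Nodup.map_on (fun x hx y hy h => ?_) List.nodup_range
  have := congrArg Fin.val h
  rw [List.mem_range] at hx hy
  have h1 : s + x < n := by omega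
  have h2 : s + y < n := by omega
  simpa [Nat.mod_eq_of_lt h1, Nat.mod_eq_of_lt h2] using this

lemma prefixProd_add_eq (α : Fin n → V) (s k : ℕ) :
    prefixProd α (s + k) = word α (lowerList n s) * word α (upperList n s k) := by
  rw [prefixProd_eq_word, List.range_add, List.map_append, word_append, lowerList, upperList,
    List.map_map]
  rfl

namespace IsPerronPair

lemma orth_lower (h : IsPerronPair b s c θ p q) :
    ∀ i ∈ lowerList n s, ∀ j ∈ lowerList n s, i ≠ j → ⟪b i, b j⟫_ℝ = 0 := fun i hi j hj hij =>
  h.orth₁ i j hij ((mem_lowerList h.le).mp hi) ((mem_lowerList h.le).mp hj)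

lemma orth_upper (h : IsPerronPair b s c θ p q) :
    ∀ i ∈ upperList n s (n - s), ∀ j ∈ upperList n s (n - s), i ≠ j → ⟪b i, b j⟫_ℝ = 0 :=
  fun i hi j hj hij => h.orth₂ i j hij
    ((mem_upperList (by have := h.le; omega)).mp hi).1
    ((mem_upperList (by have := h.le; omega)).mp hj).1

lemma coxeterElt_eq (h : IsPerronPair b s c θ p q) :
    coxeterElt b = word b (lowerList n s) * word b (upperList n s (n - s)) := by
  rw [← prefixProd_add_eq, Nat.add_sub_cancel' h.le]; rfl

lemma lower_mul_self (h : IsPerronPair b s c θ p q) :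
    word b (lowerList n s) * word b (lowerList n s) = 1 :=
  word_mul_self_of_orthogonal h.norm_eq (nodup_lowerList h.le) h.orth_lower

lemma upper_mul_self (h : IsPerronPair b s c θ p q) :
    word b (upperList n s (n - s)) * word b (upperList n s (n - s)) = 1 :=
  word_mul_self_of_orthogonal h.norm_eq
    (nodup_upperList (by have := h.le; omega)) h.orth_upper

lemma lower_q (h : IsPerronPair b s c θ p q) : word b (lowerList n s) q = q :=
  word_apply_eq_self h.norm_eq fun i hi => by
    rw [real_inner_comm, h.inner_q, if_pos ((mem_lowerList h.le).mp hi)]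

lemma upper_p (h : IsPerronPair b s c θ p q) : word b (upperList n s (n - s)) p = p :=
  word_apply_eq_self h.norm_eq fun i hi => by
    have := ((mem_upperList (by have := h.le; omega)).mp hi).1
    rw [real_inner_comm, h.inner_p, if_neg (by omega)]

lemma sum_lower_add_sum_upper (h : IsPerronPair b s c θ p q) :
    ∑ i ∈ (lowerList n s).toFinset, c i • b i + ∑ i ∈ (upperList n s (n - s)).toFinset, c i • b i =
      ∑ i, c i • b i := by
  rw [← Finset.sum_union]
  · congr 1
    ext i
    have := h.le
    have := i.2
    simp only [Finset.mem_union, List.mem_toFinset, mem_lowerList h.le,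
      mem_upperList (show s + (n - s) ≤ n by omega), Finset.mem_univ, iff_true]
    omega
  · rw [Finset.disjoint_left]
    intro i hi hi'
    have := h.le
    rw [List.mem_toFinset, mem_lowerList h.le] at hi
    rw [List.mem_toFinset, mem_upperList (by omega)] at hi'
    omega

/-- Paired with a lower simple root, orthonormality gives `c i`; with an upper one, the eigenvector
equation leaves `-cos θ * c i` after removing the upper half. -/
lemma sum_lower (h : IsPerronPair b s c θ p q) :
    ∑ i ∈ (lowerList n s).toFinset, c i • b i = p - Real.cos θ • q := by
  refine ext_inner_basis b fun i => ?_
  rw [inner_sub_left, real_inner_smul_left, h.inner_p, h.inner_q]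
  have hle := h.le
  split_ifs with hi
  · rw [h.inner_sum_of_orth _ i (by simpa [mem_lowerList h.le] using hi)]
    · ring
    · intro j hj hji
      rw [List.mem_toFinset] at hj
      exact h.orth_lower j hj i ((mem_lowerList h.le).mpr hi) hji
  · have h1 := h.eig i
    rw [← h.sum_lower_add_sum_upper, inner_add_left] at h1
    have hi' : i ∈ upperList n s (n - s) :=
      (mem_upperList (by omega)).mpr ⟨by omega, by have := i.2; omega⟩
    rw [h.inner_sum_of_orth (upperList n s (n - s)).toFinset i (by simpa using hi')] at h1
    · linarith
    · intro j hj hji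
      rw [List.mem_toFinset] at hj
      exact h.orth_upper j hj i hi' hji

lemma sum_upper (h : IsPerronPair b s c θ p q) :
    ∑ i ∈ (upperList n s (n - s)).toFinset, c i • b i = q - Real.cos θ • p := by
  refine ext_inner_basis b fun i => ?_
  have h1 := h.eig i
  rw [← h.sum_lower_add_sum_upper, h.sum_lower] at h1
  simp only [inner_add_left, inner_sub_left, real_inner_smul_left, h.inner_p, h.inner_q] at h1 ⊢
  split_ifs at h1 ⊢ <;> linarith

/-- On the span of `p` and `q` the lower half acts as the reflection fixing `q`, as the upper half
acts as the one fixing `p`; the angle between the mirrors is `θ`. -/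
lemma lower_p (h : IsPerronPair b s c θ p q) :
    word b (lowerList n s) p = (2 * Real.cos θ) • q - p := by
  rw [word_apply_of_orthogonal h.norm_eq (nodup_lowerList h.le) h.orth_lower]
  have : ∑ i ∈ (lowerList n s).toFinset, ⟪b i, p⟫_ℝ • b i = p - Real.cos θ • q := by
    rw [← h.sum_lower]
    refine Finset.sum_congr rfl fun i hi => ?_
    rw [List.mem_toFinset, mem_lowerList h.le] at hi
    rw [real_inner_comm, h.inner_p, if_pos hi]
  rw [this]
  module

lemma upper_q (h : IsPerronPair b s c θ p q) :
    word b (upperList n s (n - s)) q = (2 * Real.cos θ) • p - q := by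
  have hle : s + (n - s) ≤ n := by have := h.le; omega
  rw [word_apply_of_orthogonal h.norm_eq (nodup_upperList hle) h.orth_upper]
  have : ∑ i ∈ (upperList n s (n - s)).toFinset, ⟪b i, q⟫_ℝ • b i = q - Real.cos θ • p := by
    rw [← h.sum_upper]
    refine Finset.sum_congr rfl fun i hi => ?_
    rw [List.mem_toFinset, mem_upperList hle] at hi
    rw [real_inner_comm, h.inner_q, if_neg (by omega)]
  rw [this]
  module

lemma coxeterElt_inv (h : IsPerronPair b s c θ p q) :
    (coxeterElt b)⁻¹ = word b (upperList n s (n - s)) * word b (lowerList n s) := by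
  rw [h.coxeterElt_eq, mul_inv_rev, ← eq_inv_of_mul_eq_one_left h.lower_mul_self,
    ← eq_inv_of_mul_eq_one_left h.upper_mul_self]

/-- The Chebyshev recurrence behind the iteration of the rotation through `2θ`. -/
lemma sin_add_two (x θ : ℝ) :
    Real.sin (x + 2 * θ) = 2 * Real.cos θ * Real.sin (x + θ) - Real.sin x := by
  have h1 : x + 2 * θ = (x + θ) + θ := by ring
  have h2 : Real.sin x = Real.sin ((x + θ) - θ) := by ring_nf
  rw [h1, h2, Real.sin_add, Real.sin_sub]
  ring

/-- A rotation through `2tθ` in the oblique frame `p`, `q`; the factor `sin θ` clears the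
denominators. -/
lemma coxeterElt_inv_pow (h : IsPerronPair b s c θ p q) (t : ℕ) :
    Real.sin θ • ((coxeterElt b)⁻¹ ^ t) p =
        Real.sin (2 * t * θ + θ) • p - Real.sin (2 * t * θ) • q ∧
      Real.sin θ • ((coxeterElt b)⁻¹ ^ t) q =
        Real.sin (2 * t * θ) • p - Real.sin (2 * t * θ - θ) • q := by
  induction t with
  | zero => simp
  | succ t ih =>
    have e1 : ∀ x, Real.sin θ • ((coxeterElt b)⁻¹ ^ (t + 1)) x =
        (coxeterElt b)⁻¹ (Real.sin θ • ((coxeterElt b)⁻¹ ^ t) x) :=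
      fun x => by rw [pow_succ', map_smul]; rfl
    have hp : (coxeterElt b)⁻¹ p = (4 * Real.cos θ ^ 2 - 1) • p - (2 * Real.cos θ) • q := by
      rw [h.coxeterElt_inv, isometry_mul_apply, h.lower_p, map_sub, map_smul, h.upper_q, h.upper_p]
      module
    have hq : (coxeterElt b)⁻¹ q = (2 * Real.cos θ) • p - q := by
      rw [h.coxeterElt_inv, isometry_mul_apply, h.lower_q, h.upper_q]
    have t0 := sin_add_two (2 * t * θ - θ) θ
    have t1 := sin_add_two (2 * t * θ) θ
    have t2 := sin_add_two (2 * t * θ + θ) θ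
    rw [e1, e1, ih.1, ih.2, map_sub, map_sub, map_smul, map_smul, map_smul,
      map_smul, hp, hq]
    have a1 : 2 * ((t + 1 : ℕ) : ℝ) * θ + θ = 2 * t * θ + θ + 2 * θ := by push_cast; ring
    have a2 : 2 * ((t + 1 : ℕ) : ℝ) * θ = 2 * t * θ + 2 * θ := by push_cast; ring
    have a3 : 2 * ((t + 1 : ℕ) : ℝ) * θ - θ = 2 * t * θ + θ := by push_cast; ring
    have a4 : 2 * (t : ℝ) * θ - θ + θ = 2 * t * θ := by ring
    have a5 : 2 * (t : ℝ) * θ - θ + 2 * θ = 2 * t * θ + θ := by ring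
    have a6 : 2 * (t : ℝ) * θ + θ + θ = 2 * t * θ + 2 * θ := by ring
    rw [a6, t1] at t2
    rw [a4, a5] at t0
    rw [a3, a1, a2, t2, t1]
    have t0' : Real.sin (2 * t * θ - θ) =
      2 * Real.cos θ * Real.sin (2 * t * θ) - Real.sin (2 * t * θ + θ) := by linarith
    constructor
    · module
    · rw [t0']
      module

/-- The position of `rho b j` in the alternating sequence of orthogonal blocks. -/
def _root_.BradyWatt.blockIndex (n s j : ℕ) : ℕ := 2 * (j / n) + if j % n < s then 0 else 1

/-- Reflections within one half fix each other's roots, so only completed halves of the Coxeter word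
move a root. -/
lemma rho_lower (h : IsPerronPair b s c θ p q) {r : ℕ} (hr : r < s) :
    rho b r = b (Fin.ofNat n r) := by
  rw [rho, prefixProd_eq_word]
  have hle := h.le
  refine word_apply_eq_self h.norm_eq fun i hi => ?_
  have hi' := (mem_lowerList (show r ≤ n by omega)).mp hi
  have hv : ((Fin.ofNat n r : Fin n) : ℕ) = r := by
    simp [Nat.mod_eq_of_lt (show r < n by omega)]
  refine h.orth₁ _ _ ?_ (by omega) (by omega)
  rintro rfl
  omega

lemma rho_upper (h : IsPerronPair b s c θ p q) {r : ℕ} (hr : s ≤ r) (hn : r < n) :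
    rho b r = word b (lowerList n s) (b (Fin.ofNat n r)) := by
  obtain ⟨k, rfl⟩ := Nat.exists_eq_add_of_le hr
  rw [rho, prefixProd_add_eq, isometry_mul_apply]
  congr 1
  refine word_apply_eq_self h.norm_eq fun i hi => ?_
  have hi' := (mem_upperList (show s + k ≤ n by omega)).mp hi
  have hv : ((Fin.ofNat n (s + k) : Fin n) : ℕ) = s + k := by simp [Nat.mod_eq_of_lt hn]
  refine h.orth₂ _ _ ?_ (by omega) (by omega)
  rintro rfl
  omega

lemma inner_pow_apply (γ : V ≃ₗᵢ[ℝ] V) (t : ℕ) (x y : V) :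
    ⟪x, (γ ^ t) y⟫_ℝ = ⟪(γ⁻¹ ^ t) x, y⟫_ℝ := by
  rw [← (γ ^ t).inner_map_map ((γ⁻¹ ^ t) x) y, ← isometry_mul_apply, inv_pow, mul_inv_cancel]
  rfl

/-- The root `rho b j` projects to the direction of angle `(blockIndex n s j) * θ` in the
Coxeter plane. -/
lemma inner_rho (h : IsPerronPair b s c θ p q) (j : ℕ) :
    Real.sin θ * ⟪p, rho b j⟫_ℝ =
        Real.sin (blockIndex n s j * θ + θ) * c (Fin.ofNat n j) ∧
      Real.sin θ * ⟪q, rho b j⟫_ℝ = Real.sin (blockIndex n s j * θ) * c (Fin.ofNat n j) := by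
  have hn : 0 < n := Nat.pos_of_ne_zero (NeZero.ne n)
  have hj : n * (j / n) + j % n = j := Nat.div_add_mod j n
  have hmod := Nat.mod_lt j hn
  have hidx : Fin.ofNat n (j % n) = Fin.ofNat n j := by ext; simp
  have hval : ((Fin.ofNat n j : Fin n) : ℕ) = j % n := rfl
  obtain ⟨hp, hq⟩ := h.coxeterElt_inv_pow (j / n)
  have hr : rho b j = (coxeterElt b ^ (j / n)) (rho b (j % n)) := by rw [← rho_mul_add, hj]
  rw [hr, inner_pow_apply, inner_pow_apply, ← real_inner_smul_left, ← real_inner_smul_left, hp, hq,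
    blockIndex]
  by_cases hs : j % n < s
  · rw [h.rho_lower hs, if_pos hs, hidx]
    simp only [inner_sub_left, real_inner_smul_left, h.inner_p, h.inner_q, hval, if_pos hs]
    push_cast
    constructor <;> ring_nf
  · rw [h.rho_upper (by omega) hmod, if_neg hs, hidx]
    have e1 : ∀ x, ⟪x, word b (lowerList n s) (b (Fin.ofNat n j))⟫_ℝ =
        ⟪word b (lowerList n s) x, b (Fin.ofNat n j)⟫_ℝ := fun x => by
      rw [← (word b (lowerList n s)).inner_map_map (word b (lowerList n s) x),
        ← isometry_mul_apply, h.lower_mul_self]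
      rfl
    rw [e1, e1]
    simp only [map_sub, map_smul, h.lower_p, h.lower_q, inner_sub_left, real_inner_smul_left,
      h.inner_p, h.inner_q, hval, if_neg hs]
    have t0 := sin_add_two (2 * (j / n : ℕ) * θ - θ) θ
    have t1 := sin_add_two (2 * (j / n : ℕ) * θ) θ
    have a4 : 2 * ((j / n : ℕ) : ℝ) * θ - θ + θ = 2 * (j / n : ℕ) * θ := by ring
    have a5 : 2 * ((j / n : ℕ) : ℝ) * θ - θ + 2 * θ = 2 * (j / n : ℕ) * θ + θ := by ring
    rw [a4, a5] at t0
    have b1 : ((2 * (j / n) + 1 : ℕ) : ℝ) * θ + θ = 2 * (j / n : ℕ) * θ + 2 * θ := by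
      push_cast; ring
    have b2 : ((2 * (j / n) + 1 : ℕ) : ℝ) * θ = 2 * (j / n : ℕ) * θ + θ := by
      push_cast; ring
    rw [b1, b2, t1, t0]
    constructor <;> ring

end IsPerronPair

end Bipartite

/-! ### The angle `θ = π / h` and the signs of the `ρ_j`. -/

section Period

variable {V : Type*} [NormedAddCommGroup V] [InnerProductSpace ℝ V] {n : ℕ}
  {W : Subgroup (V ≃ₗᵢ[ℝ] V)} {b : Module.Basis (Fin n) ℝ V} {s : ℕ} {c : Fin n → ℝ} {θ : ℝ}
  {p q : V}

namespace IsPerronPair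

lemma inner_p_nonneg (h : IsPerronPair b s c θ p q) {v : V} (hv : IsNonneg b v) :
    0 ≤ ⟪p, v⟫_ℝ := by
  rw [real_inner_comm]
  refine hv.inner_nonneg fun i => ?_
  rw [real_inner_comm, h.inner_p]
  split_ifs
  exacts [(h.pos i).le, le_rfl]

lemma inner_q_nonneg (h : IsPerronPair b s c θ p q) {v : V} (hv : IsNonneg b v) :
    0 ≤ ⟪q, v⟫_ℝ := by
  rw [real_inner_comm]
  refine hv.inner_nonneg fun i => ?_
  rw [real_inner_comm, h.inner_q]
  split_ifs
  exacts [le_rfl, (h.pos i).le]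

variable [NeZero n]

/-- Since `p` and `q` lie in the closed chamber, the sign of a root controls its pairings with them,
which `inner_rho` expresses by sines with positive factors. -/
lemma sin_nonneg_of_nonneg (h : IsPerronPair b s c θ p q) {j : ℕ} (hj : IsNonneg b (rho b j)) :
    0 ≤ Real.sin (blockIndex n s j * θ + θ) ∧ 0 ≤ Real.sin (blockIndex n s j * θ) := by
  have h1 := mul_nonneg h.sin_pos.le (h.inner_p_nonneg hj)
  have h2 := mul_nonneg h.sin_pos.le (h.inner_q_nonneg hj)
  rw [(h.inner_rho j).1] at h1
  rw [(h.inner_rho j).2] at h2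
  exact ⟨nonneg_of_mul_nonneg_left h1 (h.pos _), nonneg_of_mul_nonneg_left h2 (h.pos _)⟩

lemma sin_nonpos_of_neg (h : IsPerronPair b s c θ p q) {j : ℕ} (hj : IsNonneg b (-(rho b j))) :
    Real.sin (blockIndex n s j * θ + θ) ≤ 0 ∧ Real.sin (blockIndex n s j * θ) ≤ 0 := by
  have h1 := mul_nonneg h.sin_pos.le (h.inner_p_nonneg hj)
  have h2 := mul_nonneg h.sin_pos.le (h.inner_q_nonneg hj)
  rw [inner_neg_right, mul_neg, (h.inner_rho j).1, ← neg_mul] at h1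
  rw [inner_neg_right, mul_neg, (h.inner_rho j).2, ← neg_mul] at h2
  exact ⟨neg_nonneg.mp (nonneg_of_mul_nonneg_left h1 (h.pos _)),
    neg_nonneg.mp (nonneg_of_mul_nonneg_left h2 (h.pos _))⟩

/-- The angle of the Coxeter plane is `π / m` for some `m`. -/
lemma exists_period (h : IsPerronPair b s c θ p q) (hs : IsSimpleSystem W (Set.range b)) :
    ∃ m : ℕ, 2 ≤ m ∧ m * θ = Real.pi := by
  have hn : 0 < n := Nat.pos_of_ne_zero (NeZero.ne n)
  by_cases hdeg : s = 0 ∨ s = n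
  -- With one half empty all simple roots are orthogonal, so the eigenvalue is 1, `cos θ = 0` and `θ
  -- = π / 2`.
  · refine ⟨2, le_rfl, ?_⟩
    have hsum : ⟪∑ j, c j • b j, b 0⟫_ℝ = c 0 := by
      refine h.inner_sum_of_orth _ 0 (Finset.mem_univ _) fun j _ hj => ?_
      rcases hdeg with hd | hd
      · exact h.orth₂ j 0 hj (by omega) (by omega)
      · exact h.orth₁ j 0 hj (by omega) (by rw [hd]; exact (0 : Fin n).2)
    have h1 := h.eig 0
    rw [hsum] at h1
    have h2 : Real.cos θ = 0 := by nlinarith [h.pos 0]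
    have h3 := h.theta_le
    rcases lt_or_eq_of_le h3 with h4 | h4
    · exact absurd h2 (Real.cos_pos_of_mem_Ioo ⟨by linarith [h.theta_pos], h4⟩).ne'
    · rw [h4]; push_cast; ring
  · push Not at hdeg
    have hle := h.le
    have hex : ∃ m : ℕ, Real.pi ≤ m * θ := by
      obtain ⟨m, hm⟩ := exists_nat_ge (Real.pi / θ)
      exact ⟨m, (div_le_iff₀ h.theta_pos).mp hm⟩
    classical
    -- Take the least `m` with `m θ ≥ π`. The angle of block `m - 1` lies in `(0, π)`, so its roots
    -- are positive; hence `sin (m θ) ≥ 0`, which excludes `m θ > π`.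
    set m := Nat.find hex with hm
    have hm1 : Real.pi ≤ m * θ := Nat.find_spec hex
    have hm2 : 2 ≤ m := by
      by_contra! hlt
      have h1 : (m : ℝ) ≤ 1 := by exact_mod_cast Nat.le_of_lt_succ hlt
      have := mul_le_mul_of_nonneg_right h1 h.theta_pos.le
      linarith [h.theta_le, Real.pi_pos]
    obtain ⟨k, hk⟩ : ∃ k, m = k + 1 := ⟨m - 1, by omega⟩
    have hk1 : (k : ℝ) * θ < Real.pi := not_le.mp (Nat.find_min hex (m := k) (by omega))
    have hk0 : 0 < (k : ℝ) * θ := mul_pos (by exact_mod_cast (by omega : 0 < k)) h.theta_pos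
    refine ⟨m, hm2, le_antisymm ?_ hm1⟩
    -- Every block occurs because both halves are nonempty.
    obtain ⟨j, hj⟩ : ∃ j, blockIndex n s j = k := by
      rcases Nat.even_or_odd' k with ⟨t, ht | ht⟩
      · refine ⟨n * t, ?_⟩
        rw [blockIndex, Nat.mul_div_cancel_left _ hn, Nat.mul_mod_right, if_pos (by omega)]
        omega
      · refine ⟨n * t + s, ?_⟩
        have hsn : s < n := by omega
        rw [blockIndex, Nat.mul_add_div hn, Nat.mul_add_mod, Nat.mod_eq_of_lt hsn,
          Nat.div_eq_of_lt hsn, if_neg (lt_irrefl s)]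
        omega
    have hsin : 0 < Real.sin (k * θ) := Real.sin_pos_of_pos_of_lt_pi hk0 hk1
    have hpos : IsNonneg b (rho b j) := by
      rcases hs.isNonneg_or (hs.rho_mem j) with hp | hp
      · exact hp
      · have := (h.sin_nonpos_of_neg hp).2
        rw [hj] at this
        linarith
    have h1 := (h.sin_nonneg_of_nonneg hpos).1
    rw [hj] at h1
    have h2 : (m : ℝ) * θ = k * θ + θ := by rw [hk]; push_cast; ring
    rw [h2]
    by_contra! hlt
    have h3 : 0 < Real.sin (k * θ + θ - Real.pi) :=
      Real.sin_pos_of_pos_of_lt_pi (by linarith) (by linarith [h.theta_le, Real.pi_pos])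
    rw [Real.sin_sub_pi] at h3
    linarith

/-- A negative root would have nonpositive sines, but the angle of its block lies in `(0, π)`. In
block 0, where the `q`-coordinate vanishes, the `p`-coordinate decides. -/
lemma rho_nonneg (h : IsPerronPair b s c θ p q) (hs : IsSimpleSystem W (Set.range b)) {m : ℕ}
    (hm : m * θ = Real.pi) {j : ℕ} (hj : blockIndex n s j < m) : IsNonneg b (rho b j) := by
  rcases hs.isNonneg_or (hs.rho_mem j) with hp | hp
  · exact hp
  · have h1 := h.sin_nonpos_of_neg hp
    have h2 : (blockIndex n s j : ℝ) * θ < Real.pi := by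
      rw [← hm]; exact mul_lt_mul_of_pos_right (by exact_mod_cast hj) h.theta_pos
    rcases Nat.eq_zero_or_pos (blockIndex n s j) with h0 | h0
    · have := h1.1
      rw [h0] at this
      simp only [Nat.cast_zero, zero_mul, zero_add] at this
      linarith [h.sin_pos]
    · have h3 : 0 < (blockIndex n s j : ℝ) * θ := mul_pos (by exact_mod_cast h0) h.theta_pos
      linarith [Real.sin_pos_of_pos_of_lt_pi h3 h2]

lemma rho_neg (h : IsPerronPair b s c θ p q) (hs : IsSimpleSystem W (Set.range b)) {m : ℕ}
    (hm : m * θ = Real.pi) {j : ℕ} (hj : m ≤ blockIndex n s j) (hj' : blockIndex n s j < 2 * m) :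
    IsNonneg b (-(rho b j)) := by
  rcases hs.isNonneg_or (hs.rho_mem j) with hp | hp
  · have h1 := h.sin_nonneg_of_nonneg hp
    obtain ⟨k, hk⟩ := Nat.exists_eq_add_of_le hj
    have hkm : k < m := by omega
    have e1 : (blockIndex n s j : ℝ) * θ = k * θ + Real.pi := by
      rw [hk, ← hm]; push_cast; ring
    have e2 : (blockIndex n s j : ℝ) * θ + θ = k * θ + θ + Real.pi := by rw [e1]; ring
    rw [e2, e1, Real.sin_add_pi, Real.sin_add_pi] at h1
    have h2 : (k : ℝ) * θ < Real.pi := by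
      rw [← hm]; exact mul_lt_mul_of_pos_right (by exact_mod_cast hkm) h.theta_pos
    rcases Nat.eq_zero_or_pos k with h0 | h0
    · have := h1.1
      rw [h0] at this
      simp only [Nat.cast_zero, zero_mul, zero_add] at this
      linarith [h.sin_pos]
    · have h3 : 0 < (k : ℝ) * θ := mul_pos (by exact_mod_cast h0) h.theta_pos
      linarith [Real.sin_pos_of_pos_of_lt_pi h3 h2]
  · exact hp

/-- The power is a full turn of the Coxeter plane, so it fixes `p + q`, which lies in the open
chamber. -/
lemma coxeterElt_pow_eq_one (h : IsPerronPair b s c θ p q) (hs : IsSimpleSystem W (Set.range b))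
    (hfin : Finite W) (hgen : Subgroup.closure (reflections W) = W) {m : ℕ}
    (hm : m * θ = Real.pi) : coxeterElt b ^ m = 1 := by
  obtain ⟨h1, h2⟩ := h.coxeterElt_inv_pow m
  have e : 2 * (m : ℝ) * θ = 2 * Real.pi := by rw [mul_assoc, hm]
  have e1 : Real.sin (2 * m * θ + θ) = Real.sin θ := by
    rw [e, add_comm, Real.sin_add_two_pi]
  have e2 : Real.sin (2 * m * θ) = 0 := by rw [e, Real.sin_two_pi]
  have e3 : Real.sin (2 * m * θ - θ) = -Real.sin θ := by
    rw [e, Real.sin_two_pi_sub]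
  rw [e1, e2, zero_smul, sub_zero] at h1
  rw [e2, e3, zero_smul, zero_sub, neg_smul, neg_neg] at h2
  have h3 := smul_right_injective V h.sin_pos.ne' h1
  have h4 := smul_right_injective V h.sin_pos.ne' h2
  rw [← inv_inj, inv_one, ← inv_pow]
  refine hs.eq_one_of_fixed_regular hfin hgen
    (W.pow_mem (W.inv_mem hs.coxeterElt_mem) _) (x := p + q) (by rw [map_add, h3, h4]) ?_
  have hreg : ∀ i, 0 < ⟪b i, p + q⟫_ℝ := by
    intro i
    rw [real_inner_comm, inner_add_left, h.inner_p, h.inner_q]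
    split_ifs <;> simpa using h.pos i
  intro β hβ
  rcases hs.isNonneg_or hβ with hp | hp
  · exact (hp.inner_pos (ne_zero_of_mem_roots hβ) hreg).ne'
  · have := hp.inner_pos (neg_ne_zero.mpr (ne_zero_of_mem_roots hβ)) hreg
    rw [inner_neg_left] at this
    linarith

/-- An earlier power equal to 1 would force `sin (2tθ) = 0`, so `2tθ = π`; but a half turn negates
`p` and `q`. -/
lemma orderOf_coxeterElt (h : IsPerronPair b s c θ p q) (hs : IsSimpleSystem W (Set.range b))
    (hfin : Finite W) (hgen : Subgroup.closure (reflections W) = W) {m : ℕ} (hm0 : 0 < m)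
    (hm : m * θ = Real.pi) : orderOf (coxeterElt b) = m := by
  rw [orderOf_eq_iff hm0]
  refine ⟨h.coxeterElt_pow_eq_one hs hfin hgen hm, fun t ht ht0 h1 => ?_⟩
  obtain ⟨hp, hq⟩ := h.coxeterElt_inv_pow t
  rw [inv_pow, h1, inv_one] at hp hq
  have hp' := congrArg (fun x => ⟪x, b 0⟫_ℝ) hp
  have hq' := congrArg (fun x => ⟪x, b 0⟫_ℝ) hq
  have i1 : ∀ x : V, (1 : V ≃ₗᵢ[ℝ] V) x = x := fun _ => rfl
  simp only [i1, inner_sub_left, real_inner_smul_left, h.inner_p, h.inner_q] at hp' hq'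
  have hc := h.pos 0
  have hS : Real.sin (2 * t * θ) = 0 := by
    split_ifs at hp' hq'
    · have : Real.sin (2 * t * θ) * c 0 = 0 := by linarith
      exact (mul_eq_zero.mp this).resolve_right hc.ne'
    · have : Real.sin (2 * t * θ) * c 0 = 0 := by linarith
      exact (mul_eq_zero.mp this).resolve_right hc.ne'
  have ht1 : 0 < (t : ℝ) * θ := mul_pos (by exact_mod_cast ht0) h.theta_pos
  have ht2 : (t : ℝ) * θ < Real.pi := by
    rw [← hm]; exact mul_lt_mul_of_pos_right (by exact_mod_cast ht) h.theta_pos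
  have hpi : 2 * (t : ℝ) * θ = Real.pi := by
    rcases lt_trichotomy (2 * (t : ℝ) * θ) Real.pi with hlt | heq | hgt
    · exact absurd hS (Real.sin_pos_of_pos_of_lt_pi (by linarith) hlt).ne'
    · exact heq
    · have := Real.sin_pos_of_pos_of_lt_pi (x := 2 * (t : ℝ) * θ - Real.pi)
        (by linarith) (by linarith)
      rw [Real.sin_sub_pi, hS] at this
      simp at this
  have hsin := h.sin_pos
  rw [hpi, add_comm, Real.sin_add_pi, Real.sin_pi] at hp'
  rw [hpi, Real.sin_pi_sub, Real.sin_pi] at hq'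
  split_ifs at hp' hq'
  · nlinarith
  · nlinarith

/-- The two halves are involutions generating a dihedral group. When their product has odd period
they are conjugate, so their moved spaces have equal dimensions `s` and `n - s`. -/
lemma two_mul_eq_of_odd (h : IsPerronPair b s c θ p q) {t : ℕ}
    (ht : coxeterElt b ^ (2 * t + 1) = 1) : 2 * s = n := by
  have := b.finiteDimensional_of_finite
  have hle := h.le
  have hle' : s + (n - s) ≤ n := by omega
  set u := word b (lowerList n s) with hu
  set v := word b (upperList n s (n - s)) with hv
  have huu : u * u = 1 := h.lower_mul_self
  have hvv : v * v = 1 := h.upper_mul_self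
  have hγ : coxeterElt b = u * v := h.coxeterElt_eq
  have hui : u⁻¹ = u := inv_eq_of_mul_eq_one_right huu
  have h1 : Module.finrank ℝ (movedSpace u) = s := by
    rw [hu, finrank_movedSpace_word h.norm_eq b.linearIndependent (nodup_lowerList hle)]
    simp [lowerList]
  have h2 : Module.finrank ℝ (movedSpace v) = n - s := by
    rw [hv, finrank_movedSpace_word h.norm_eq b.linearIndependent (nodup_upperList hle')]
    simp [upperList]
  have hconj : u * (u * v) ^ t * u⁻¹ = (u * v) ^ (t + 1) := by
    have e1 : u * (u * v) * u⁻¹ = (u * v)⁻¹ := by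
      rw [mul_inv_rev, hui, inv_eq_of_mul_eq_one_right hvv, ← mul_assoc, huu, one_mul]
    rw [← conj_pow, e1, inv_pow, inv_eq_iff_mul_eq_one, ← pow_add, ← hγ]
    rw [show t + (t + 1) = 2 * t + 1 by ring, ht]
  have hx : (u * v) ^ t * u * v * ((u * v) ^ t * u)⁻¹ = u := by
    rw [mul_inv_eq_iff_eq_mul, mul_assoc ((u * v) ^ t), ← pow_succ, ← hconj, hui, mul_assoc]
  have h3 := finrank_movedSpace_conj ((u * v) ^ t * u) v
  rw [hx, h1, h2] at h3
  omega

end IsPerronPair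

variable [NeZero n]

/-- Block sizes alternate between `s` and `n - s`, so the first `m` blocks hold `n * m / 2` indices;
for odd `m` this needs equal halves. -/
lemma blockIndex_lt_iff {s m j : ℕ} (hm : Odd m → 2 * s = n) :
    blockIndex n s j < m ↔ j < n * m / 2 := by
  have hn : 0 < n := Nat.pos_of_ne_zero (NeZero.ne n)
  have hj : n * (j / n) + j % n = j := Nat.div_add_mod j n
  have hmod := Nat.mod_lt j hn
  rw [blockIndex]
  set a := j / n
  set r := j % n
  rcases Nat.even_or_odd' m with ⟨t, rfl | rfl⟩
  · have h1 : n * (2 * t) / 2 = n * t := by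
      rw [show n * (2 * t) = 2 * (n * t) by ring]; simp
    rw [h1, ← hj]
    constructor
    · intro h
      have h2 : a + 1 ≤ t := by split_ifs at h <;> omega
      have := Nat.mul_le_mul_left n h2
      rw [mul_add, mul_one] at this
      omega
    · intro h
      have h2 : a < t := by
        by_contra! h3
        have := Nat.mul_le_mul_left n h3
        omega
      split_ifs <;> omega
  · have hs : 2 * s = n := hm ⟨t, rfl⟩
    have h1 : n * (2 * t + 1) / 2 = n * t + s := by
      rw [show n * (2 * t + 1) = 2 * (n * t + s) by rw [← hs]; ring]; simp
    rw [h1, ← hj]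
    rcases lt_trichotomy a t with h | h | h
    · have := Nat.mul_le_mul_left n (show a + 1 ≤ t from h)
      rw [mul_add, mul_one] at this
      constructor
      · intro _; omega
      · intro _; split_ifs <;> omega
    · rw [h]
      split_ifs <;> omega
    · have := Nat.mul_le_mul_left n (show t + 1 ≤ a from h)
      rw [mul_add, mul_one] at this
      constructor
      · intro h'; split_ifs at h' <;> omega
      · intro _; omega

/-- The signs of the roots `rho b j` in a bipartite simple system. -/
lemma IsSimpleSystem.rho_sign (hs : IsSimpleSystem W (Set.range b))
    (hW : IsFiniteIrreducibleReflectionGroup W) (hle : s ≤ n)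
    (horth₁ : ∀ i j : Fin n, i ≠ j → (i : ℕ) < s → (j : ℕ) < s → ⟪b i, b j⟫_ℝ = 0)
    (horth₂ : ∀ i j : Fin n, i ≠ j → s ≤ (i : ℕ) → s ≤ (j : ℕ) → ⟪b i, b j⟫_ℝ = 0) :
    0 < orderOf (coxeterElt b) ∧
    (∀ j, j < n * orderOf (coxeterElt b) / 2 → IsNonneg b (rho b j)) ∧
    ∀ j, n * orderOf (coxeterElt b) / 2 ≤ j → j < n * orderOf (coxeterElt b) →
      IsNonneg b (-(rho b j)) := by
  obtain ⟨c, l, hc, hl0, hl1, heig⟩ := hs.exists_perron hW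
  obtain ⟨p, hp⟩ := exists_inner_basis_eq b fun i => if (i : ℕ) < s then c i else 0
  obtain ⟨q, hq⟩ := exists_inner_basis_eq b fun i => if (i : ℕ) < s then 0 else c i
  have h : IsPerronPair b s c (Real.arccos l) p q :=
    { norm_eq := hs.norm_simple
      le := hle
      orth₁ := horth₁
      orth₂ := horth₂
      pos := hc
      eig := by rwa [Real.cos_arccos (by linarith) hl1.le]
      theta_pos := Real.arccos_pos.mpr hl1
      theta_le := Real.arccos_le_pi_div_two.mpr hl0
      inner_p := hp
      inner_q := hq }
  obtain ⟨m, hm2, hm⟩ := h.exists_period hs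
  have hord := h.orderOf_coxeterElt hs hW.finite hW.generated (by omega) hm
  have hodd : Odd m → 2 * s = n := by
    rintro ⟨t, rfl⟩
    exact h.two_mul_eq_of_odd (h.coxeterElt_pow_eq_one hs hW.finite hW.generated hm)
  rw [hord]
  refine ⟨by omega, fun j hj => ?_, fun j hj hj' => ?_⟩
  · exact h.rho_nonneg hs hm ((blockIndex_lt_iff hodd).mpr hj)
  · refine h.rho_neg hs hm (not_lt.mp fun h' => ?_) ?_
    · exact absurd ((blockIndex_lt_iff hodd).mp h') (by omega)
    -- The bound `2 * m` is even, so the parity condition is vacuous.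
    · rw [blockIndex_lt_iff (fun h => absurd h (by simp))]
      rw [show n * (2 * m) = 2 * (n * m) by ring]
      simpa using hj'

end Period

/-! ### The map `2 (1 - γ)⁻¹` and the order of the positive roots. -/

section Order

variable {V : Type*} [NormedAddCommGroup V] [InnerProductSpace ℝ V] {n : ℕ} [NeZero n]
  {W : Subgroup (V ≃ₗᵢ[ℝ] V)} {b : Module.Basis (Fin n) ℝ V} {N : ℕ}

lemma prefixProd_succ_inv_apply (α : Fin n → V) (i : ℕ) (x : V) :
    (prefixProd α (i + 1))⁻¹ x = rootRefl (α (Fin.ofNat n i)) ((prefixProd α i)⁻¹ x) := by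
  rw [prefixProd_succ, mul_inv_rev, rootRefl_inv]; rfl

lemma prefixProd_inv_rho (α : Fin n → V) (i : ℕ) :
    (prefixProd α i)⁻¹ (rho α i) = α (Fin.ofNat n i) :=
  (prefixProd α i).symm_apply_apply _

lemma prefixProd_inv_eq_iff (α : Fin n → V) (i : ℕ) (x y : V) :
    (prefixProd α i)⁻¹ x = y ↔ x = prefixProd α i y :=
  (prefixProd α i).toEquiv.symm_apply_eq

/-- Pulled back by its own prefix the root is simple. A sign change while shortening the prefix
would make it equal to `-ρ_i` for an earlier `i`, though both roots are positive. -/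
lemma IsSimpleSystem.prefixProd_inv_rho_nonneg (hs : IsSimpleSystem W (Set.range b))
    (hpos : ∀ j < N, IsNonneg b (rho b j)) {i d : ℕ} (hj : i + d < N) :
    IsNonneg b ((prefixProd b i)⁻¹ (rho b (i + d))) := by
  induction d generalizing i with
  | zero => rw [add_zero, prefixProd_inv_rho]; exact isNonneg_basis b _
  | succ d ih =>
    have h1 := ih (i := i + 1) (by omega)
    rw [show i + 1 + d = i + (d + 1) by ring] at h1
    set x := rho b (i + (d + 1)) with hx
    have hroot : ∀ k, (prefixProd b k)⁻¹ x ∈ roots W := fun k =>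
      apply_mem_roots (W.inv_mem (hs.prefixProd_mem k)) (hs.rho_mem _)
    rcases hs.isNonneg_or (hroot i) with hp | hp
    · exact hp
    · have h2 : rootRefl (b (Fin.ofNat n i)) ((prefixProd b (i + 1))⁻¹ x) =
          (prefixProd b i)⁻¹ x := by rw [prefixProd_succ_inv_apply, rootRefl_rootRefl]
      have h3 := hs.eq_simple_of_neg (hroot (i + 1)) h1 (h2.symm ▸ hp)
      rw [h3, rootRefl_self, eq_comm, prefixProd_inv_eq_iff, map_neg] at h2
      have h4 := hpos (i + (d + 1)) hj
      rw [← hx, h2] at h4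
      exact absurd h4 ((hpos i (by omega)).not_neg (hs.rho_mem i))

/-- The same argument forwards: one letter past its own prefix the root is minus a simple root, and
a return to positivity would give `ρ_j = -ρ_i`. -/
lemma IsSimpleSystem.prefixProd_inv_rho_neg (hs : IsSimpleSystem W (Set.range b))
    (hpos : ∀ j < N, IsNonneg b (rho b j)) {j d : ℕ} (hj : j + d < N) :
    IsNonneg b (-((prefixProd b (j + 1 + d))⁻¹ (rho b j))) := by
  induction d with
  | zero =>
    rw [add_zero, prefixProd_succ_inv_apply, prefixProd_inv_rho, rootRefl_self, neg_neg]
    exact isNonneg_basis b _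
  | succ d ih =>
    have h1 := ih (by omega)
    rw [← add_assoc, prefixProd_succ_inv_apply, ← map_neg]
    set i := j + 1 + d with hi
    have hroot : -((prefixProd b i)⁻¹ (rho b j)) ∈ roots W := neg_mem_roots
      (apply_mem_roots (W.inv_mem (hs.prefixProd_mem i)) (hs.rho_mem _))
    rcases hs.isNonneg_or (apply_mem_roots (hs.simple_mem (Fin.ofNat n i)).2 hroot) with hp | hp
    · exact hp
    · have h3 := hs.eq_simple_of_neg hroot h1 hp
      rw [neg_eq_iff_eq_neg, prefixProd_inv_eq_iff, map_neg] at h3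
      have h4 := hpos j (by omega)
      rw [h3] at h4
      exact absurd h4 ((hpos i (by omega)).not_neg (hs.rho_mem i))

lemma IsSimpleSystem.rho_ne (hs : IsSimpleSystem W (Set.range b))
    (hpos : ∀ j < N, IsNonneg b (rho b j)) {i j : ℕ} (hij : i < j) (hj : j < N) :
    rho b i ≠ rho b j := by
  intro h
  obtain ⟨d, rfl⟩ := Nat.exists_eq_add_of_le (show i + 1 ≤ j from hij)
  have h1 := hs.prefixProd_inv_rho_nonneg hpos hj
  rw [← h, prefixProd_succ_inv_apply, prefixProd_inv_rho, rootRefl_self] at h1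
  exact (isNonneg_basis b _).not_neg (hs.simple_mem _) h1

/-- The map `2 (1 - γ)⁻¹`, which sends a root `ρ_i` to the ray `μ_i`. -/
def IsEulerMap (γ : V ≃ₗᵢ[ℝ] V) (μ : V →ₗ[ℝ] V) : Prop :=
  ∀ x, μ x - γ (μ x) = (2 : ℝ) • x

lemma exists_eulerMap [FiniteDimensional ℝ V] {γ : V ≃ₗᵢ[ℝ] V} (hγ : ∀ x, γ x = x → x = 0) :
    ∃ μ, IsEulerMap γ μ := by
  let T : V →ₗ[ℝ] V := LinearMap.id - (γ.toLinearEquiv : V →ₗ[ℝ] V)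
  have hT : Function.Injective T := by
    rw [← LinearMap.ker_eq_bot, LinearMap.ker_eq_bot']
    intro x hx
    exact hγ x (sub_eq_zero.mp hx).symm
  refine ⟨(2 : ℝ) • ((LinearEquiv.ofInjectiveEndo T hT).symm : V →ₗ[ℝ] V), fun x => ?_⟩
  have h1 : T ((LinearEquiv.ofInjectiveEndo T hT).symm x) = x :=
    (LinearEquiv.ofInjectiveEndo T hT).apply_symm_apply x
  have h2 : (LinearEquiv.ofInjectiveEndo T hT).symm x -
    γ ((LinearEquiv.ofInjectiveEndo T hT).symm x) = x := h1
  rw [LinearMap.smul_apply, LinearEquiv.coe_coe, map_smul, ← smul_sub, h2]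

/-- Compare the norms of `μ x` and `γ (μ x) = μ x - 2 x`. -/
lemma IsEulerMap.inner_self {γ : V ≃ₗᵢ[ℝ] V} {μ : V →ₗ[ℝ] V} (hμ : IsEulerMap γ μ) (x : V) :
    ⟪μ x, x⟫_ℝ = ⟪x, x⟫_ℝ := by
  have h1 : γ (μ x) = μ x - (2 : ℝ) • x := by rw [← hμ x]; abel
  have h2 := γ.inner_map_map (μ x) (μ x)
  rw [h1, inner_sub_left, inner_sub_right, inner_sub_right, real_inner_smul_left,
    real_inner_smul_left, real_inner_smul_right, real_inner_smul_right,
    real_inner_comm (μ x) x] at h2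
  linarith

/-- From `a (c (μ u)) - μ u = -2 u ∈ M(a)`, the vector `c (μ u) - μ u` lies in both moved spaces. It
vanishes, so `c` fixes `μ u`, which is then orthogonal to `M(c)`. -/
lemma IsEulerMap.inner_eq_zero {a c : V ≃ₗᵢ[ℝ] V} {μ : V →ₗ[ℝ] V} (hμ : IsEulerMap (a * c) μ)
    (hdisj : movedSpace a ⊓ movedSpace c = ⊥) {u v : V} (hu : u ∈ movedSpace a)
    (hv : v ∈ movedSpace c) : ⟪μ u, v⟫_ℝ = 0 := by
  have h1 := hμ u
  rw [isometry_mul_apply] at h1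
  have h2 : c (μ u) - μ u = -(a (c (μ u)) - c (μ u)) - (2 : ℝ) • u := by rw [← h1]; abel
  have h3 : c (μ u) - μ u ∈ movedSpace a ⊓ movedSpace c := by
    refine ⟨?_, sub_mem_movedSpace _ _⟩
    rw [h2]
    exact Submodule.sub_mem _ (Submodule.neg_mem _ (sub_mem_movedSpace _ _))
      (Submodule.smul_mem _ _ hu)
  rw [hdisj, Submodule.mem_bot, sub_eq_zero] at h3
  rw [real_inner_comm]
  exact inner_eq_zero_of_mem_movedSpace hv h3

/-- The vector `μ (rho b i)` is the translate by `prefixProd b i` of a fundamental weight. -/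
lemma IsSimpleSystem.inner_eulerMap_rho (hs : IsSimpleSystem W (Set.range b)) {μ : V →ₗ[ℝ] V}
    (hμ : IsEulerMap (coxeterElt b) μ) (i : ℕ) (v : V) :
    ⟪μ (rho b i), v⟫_ℝ = b.repr ((prefixProd b i)⁻¹ v) (Fin.ofNat n i) := by
  classical
  set k := Fin.ofNat n i with hk
  obtain ⟨ω, hω⟩ := exists_inner_basis_eq b fun j => if j = k then 1 else 0
  have hword : ∀ (L : List (Fin n)), k ∉ L → word b L ω = ω := fun L hL =>
    word_apply_eq_self hs.norm_simple fun j hj => by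
      rw [real_inner_comm, hω, if_neg (by rintro rfl; exact hL hj)]
  have hstep : ∀ j, Fin.ofNat n j ≠ k → rootRefl (b (Fin.ofNat n j)) ω = ω := fun j hj => by
    have := hword [Fin.ofNat n j] (by simpa using hj.symm)
    simpa using this
  -- The weight `ω` is moved only by letter `k`, which does not recur among the `n - 1` letters
  -- after position `i`.
  have hsame : ∀ d, d < n → prefixProd b (i + 1 + d) ω = prefixProd b (i + 1) ω := by
    intro d
    induction d with
    | zero => intro _; rfl
    | succ d ih =>
      intro hd
      rw [← add_assoc, prefixProd_succ, isometry_mul_apply, hstep, ih (by omega)]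
      intro h
      have h1 := congrArg Fin.val h
      simp only [hk, Fin.val_ofNat] at h1
      have h2 : i + 1 + d ≡ i [MOD n] := h1
      rw [add_assoc] at h2
      have h3 : 1 + d ≡ 0 [MOD n] := Nat.ModEq.add_left_cancel' i (by simpa using h2)
      have := Nat.le_of_dvd (by omega) ((Nat.modEq_zero_iff_dvd).mp h3)
      omega
  have hn : 0 < n := Nat.pos_of_ne_zero (NeZero.ne n)
  -- Thus `(1 - γ)` sends the translate of `ω` to `2 ρ_i`; injectivity of `1 - γ` identifies that
  -- translate with `μ ρ_i`.
  have h1 : coxeterElt b (prefixProd b i ω) = prefixProd b i ω - (2 : ℝ) • rho b i := by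
    rw [← isometry_mul_apply, ← prefixProd_add, show n + i = i + 1 + (n - 1) by omega,
      hsame _ (by omega), prefixProd_succ, isometry_mul_apply, rootRefl_apply (hs.norm_simple _),
      real_inner_comm, hω, if_pos hk, mul_one, map_sub, map_smul]
    rfl
  have h2 : μ (rho b i) = prefixProd b i ω := by
    have h3 := hμ (rho b i)
    have h4 : (2 : ℝ) • rho b i = prefixProd b i ω - coxeterElt b (prefixProd b i ω) := by
      rw [h1]; abel
    rw [h4] at h3
    refine sub_eq_zero.mp (hs.eq_zero_of_coxeterElt_fixed ?_)
    rw [map_sub]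
    have h5 : coxeterElt b (μ (rho b i)) =
      μ (rho b i) - (prefixProd b i ω - coxeterElt b (prefixProd b i ω)) := by rw [← h3]; abel
    rw [h5]; abel
  have h6 : ⟪prefixProd b i ω, v⟫_ℝ = ⟪ω, (prefixProd b i)⁻¹ v⟫_ℝ := by
    rw [← (prefixProd b i).inner_map_map ω]
    congr 1
    exact ((prefixProd b i).apply_symm_apply v).symm
  rw [h2, h6, real_inner_comm, inner_eq_sum_repr b, Finset.sum_eq_single k]
  · rw [real_inner_comm, hω, if_pos rfl, mul_one]
  · intro j _ hj
    rw [real_inner_comm, hω, if_neg hj, mul_zero]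
  · simp

lemma IsSimpleSystem.inner_eulerMap_nonneg (hs : IsSimpleSystem W (Set.range b)) {μ : V →ₗ[ℝ] V}
    (hμ : IsEulerMap (coxeterElt b) μ) (hpos : ∀ j < N, IsNonneg b (rho b j)) {i j : ℕ}
    (hij : i ≤ j) (hj : j < N) : 0 ≤ ⟪μ (rho b i), rho b j⟫_ℝ := by
  obtain ⟨d, rfl⟩ := Nat.exists_eq_add_of_le hij
  rw [hs.inner_eulerMap_rho hμ]
  exact hs.prefixProd_inv_rho_nonneg hpos hj _

lemma IsSimpleSystem.inner_eulerMap_nonpos (hs : IsSimpleSystem W (Set.range b)) {μ : V →ₗ[ℝ] V}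
    (hμ : IsEulerMap (coxeterElt b) μ) (hpos : ∀ j < N, IsNonneg b (rho b j)) {i j : ℕ}
    (hij : i < j) (hj : j < N) : ⟪μ (rho b j), rho b i⟫_ℝ ≤ 0 := by
  obtain ⟨d, rfl⟩ := Nat.exists_eq_add_of_le (show i + 1 ≤ j from hij)
  rw [hs.inner_eulerMap_rho hμ]
  have := hs.prefixProd_inv_rho_neg hpos (j := i) (d := d) (by omega) (Fin.ofNat n (i + 1 + d))
  rw [map_neg, Finsupp.coe_neg, Pi.neg_apply] at this
  linarith

section Below

variable (hs : IsSimpleSystem W (Set.range b)) (hfin : Finite W)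
  (hgen : Subgroup.closure (reflections W) = W)

include hs hfin hgen

lemma IsSimpleSystem.absLE_coxeterElt_iff {σ : V ≃ₗᵢ[ℝ] V} (hσ : σ ∈ W) :
    absLE W σ (coxeterElt b) ↔ n = Module.finrank ℝ (movedSpace σ) +
      Module.finrank ℝ (movedSpace (σ⁻¹ * coxeterElt b)) := by
  rw [absLE, hs.reflLength_eq hfin hgen hσ, hs.reflLength_eq hfin hgen hs.coxeterElt_mem,
    hs.reflLength_eq hfin hgen (W.mul_mem (W.inv_mem hσ) hs.coxeterElt_mem),
    hs.movedSpace_coxeterElt, finrank_top, Module.finrank_eq_card_basis b, Fintype.card_fin]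

/-- The two moved spaces span `M(γ) = V` and their dimensions add up to `n`, so they are
complementary. -/
lemma IsSimpleSystem.inner_eulerMap_eq_zero {σ : V ≃ₗᵢ[ℝ] V} (hσ : σ ∈ W)
    (hle : absLE W σ (coxeterElt b)) {μ : V →ₗ[ℝ] V} (hμ : IsEulerMap (coxeterElt b) μ) {u v : V}
    (hu : u ∈ movedSpace σ) (hv : v ∈ movedSpace (σ⁻¹ * coxeterElt b)) : ⟪μ u, v⟫_ℝ = 0 := by
  have := b.finiteDimensional_of_finite
  rw [hs.absLE_coxeterElt_iff hfin hgen hσ] at hle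
  have hmul : σ * (σ⁻¹ * coxeterElt b) = coxeterElt b := mul_inv_cancel_left _ _
  refine IsEulerMap.inner_eq_zero (hmul.symm ▸ hμ) ?_ hu hv
  have h1 := movedSpace_mul_le σ (σ⁻¹ * coxeterElt b)
  rw [hmul, hs.movedSpace_coxeterElt, top_le_iff] at h1
  have h2 := Submodule.finrank_sup_add_finrank_inf_eq (movedSpace σ)
    (movedSpace (σ⁻¹ * coxeterElt b))
  rw [h1, finrank_top, Module.finrank_eq_card_basis b, Fintype.card_fin] at h2
  exact Submodule.finrank_eq_zero.mp (by omega)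

/-- Removing a reflection from an element below `γ`. -/
lemma IsSimpleSystem.mul_rootRefl_below {σ : V ≃ₗᵢ[ℝ] V} (hσ : σ ∈ W)
    (hle : absLE W σ (coxeterElt b)) {μ : V →ₗ[ℝ] V} (hμ : IsEulerMap (coxeterElt b) μ) {δ : V}
    (hδ : δ ∈ roots W) (hδσ : δ ∈ movedSpace σ) :
    σ * rootRefl δ ∈ W ∧ absLE W (σ * rootRefl δ) (coxeterElt b) ∧
    Module.finrank ℝ (movedSpace (σ * rootRefl δ)) + 1 = Module.finrank ℝ (movedSpace σ) ∧
    ∀ u, u ∈ movedSpace (σ * rootRefl δ) ↔ u ∈ movedSpace σ ∧ ⟪μ u, δ⟫_ℝ = 0 := by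
  have := b.finiteDimensional_of_finite
  have hmem : σ * rootRefl δ ∈ W := W.mul_mem hσ hδ.2
  have hδσ' : δ ∈ movedSpace σ⁻¹ := by rwa [movedSpace_inv]
  have hrank : Module.finrank ℝ (movedSpace (σ * rootRefl δ)) + 1 =
      Module.finrank ℝ (movedSpace σ) := by
    rw [movedSpace_mul_rootRefl, finrank_movedSpace_rootRefl_mul_of_mem hδ.1 hδσ', movedSpace_inv]
  have hsub : movedSpace (σ * rootRefl δ) ≤ movedSpace σ := by
    rw [movedSpace_mul_rootRefl, ← movedSpace_inv σ]
    exact movedSpace_rootRefl_mul_le_of_mem hδ.1 hδσ'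
  set τ := σ⁻¹ * coxeterElt b with hτ
  have e1 : (σ * rootRefl δ)⁻¹ * coxeterElt b = rootRefl δ * τ := by
    rw [mul_inv_rev, rootRefl_inv, mul_assoc]
  have e2 : σ * rootRefl δ * (rootRefl δ * τ) = coxeterElt b := by
    rw [← e1, mul_inv_cancel_left]
  have hle' := (hs.absLE_coxeterElt_iff hfin hgen hσ).mp hle
  rw [← hτ] at hle'
  have h1 := finrank_movedSpace_mul_le (rootRefl δ) τ
  rw [finrank_movedSpace_rootRefl hδ.1] at h1
  have h2 := finrank_movedSpace_mul_le (σ * rootRefl δ) (rootRefl δ * τ)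
  rw [e2, hs.movedSpace_coxeterElt, finrank_top, Module.finrank_eq_card_basis b,
    Fintype.card_fin] at h2
  have hbelow : absLE W (σ * rootRefl δ) (coxeterElt b) := by
    rw [hs.absLE_coxeterElt_iff hfin hgen hmem, e1]
    omega
  -- Dimensions force `R(δ)` to lengthen `τ`, so `δ` lies in the moved space complementary to that
  -- of `σ R(δ)`.
  have hδτ : δ ∈ movedSpace (rootRefl δ * τ) := by
    rw [mem_movedSpace_iff_finrank hδ.1, rootRefl_mul_cancel_left]
    omega
  refine ⟨hmem, hbelow, hrank, ?_⟩
  -- `K` contains `M(σ R(δ))` by orthogonality and is proper in `M(σ)` because `⟪μ δ, δ⟫ = 1`; the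
  -- codimension is one, so the two agree.
  let K : Submodule ℝ V := movedSpace σ ⊓ LinearMap.ker ((innerₛₗ ℝ δ) ∘ₗ μ)
  have hK : ∀ u, u ∈ K ↔ u ∈ movedSpace σ ∧ ⟪μ u, δ⟫_ℝ = 0 := by
    intro u
    rw [real_inner_comm]
    rfl
  have hle1 : movedSpace (σ * rootRefl δ) ≤ K := by
    intro u hu
    exact (hK u).mpr ⟨hsub hu,
      hs.inner_eulerMap_eq_zero hfin hgen hmem hbelow hμ hu (by rw [e1]; exact hδτ)⟩
  have hlt : K < movedSpace σ := by
    refine lt_of_le_of_ne inf_le_left fun h => ?_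
    have h3 : δ ∈ K := by rw [h]; exact hδσ
    have h4 := ((hK δ).mp h3).2
    rw [hμ.inner_self, real_inner_self_eq_norm_sq, hδ.1] at h4
    norm_num at h4
  have h5 := Submodule.finrank_lt_finrank_of_lt hlt
  have heq : movedSpace (σ * rootRefl δ) = K :=
    Submodule.eq_of_le_of_finrank_le hle1 (by omega)
  intro u
  rw [heq, hK]

end Below

end Order

/-! ### Existence and uniqueness of simple systems among positive roots. -/

section PositiveSystem

variable {V : Type*} [NormedAddCommGroup V] [InnerProductSpace ℝ V] {n : ℕ}
  {b : Module.Basis (Fin n) ℝ V}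

lemma hull_smul_mem {S : Set V} {r : ℝ} (hr : 0 ≤ r) {z : V} (hz : z ∈ PointedCone.hull ℝ S) :
    r • z ∈ PointedCone.hull ℝ S :=
  (PointedCone.hull ℝ S).smul_mem hr hz

lemma hull_induction {S : Set V} {Q : V → Prop} (mem : ∀ x ∈ S, Q x) (zero : Q 0)
    (add : ∀ x y, Q x → Q y → Q (x + y)) (smul : ∀ r : ℝ, 0 ≤ r → ∀ x, Q x → Q (r • x))
    {z : V} (hz : z ∈ PointedCone.hull ℝ S) : Q z :=
  Submodule.span_induction (R := {c : ℝ // 0 ≤ c}) (p := fun x _ => Q x) mem zero (fun x y _ _ => add x y)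
    (fun r x _ => smul r r.2 x) hz

lemma isNonneg_of_mem_hull {S : Set V} (hS : ∀ x ∈ S, IsNonneg b x) {z : V}
    (hz : z ∈ PointedCone.hull ℝ S) : IsNonneg b z := by
  rw [← mem_hull_basis_iff]
  exact Submodule.span_le.mpr (fun x hx => mem_hull_basis_iff.mpr (hS x hx)) hz

lemma IsNonneg.smul {r : ℝ} (hr : 0 ≤ r) {v : V} (hv : IsNonneg b v) : IsNonneg b (r • v) := by
  intro i
  rw [map_smul, Finsupp.smul_apply, smul_eq_mul]
  exact mul_nonneg hr (hv i)

lemma IsNonneg.add {v w : V} (hv : IsNonneg b v) (hw : IsNonneg b w) : IsNonneg b (v + w) := by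
  intro i
  rw [map_add, Finsupp.add_apply]
  exact add_nonneg (hv i) (hw i)

lemma IsNonneg.eq_zero_of_add {v w : V} (hv : IsNonneg b v) (hw : IsNonneg b w)
    (h : v + w = 0) : v = 0 := by
  refine hv.eq_zero ?_
  rwa [neg_eq_of_add_eq_zero_right h]

/-- A finite set of nonzero vectors in the positive cone, stable up to sign under its reflections,
lies in the cone spanned by a linearly independent subset. -/
lemma exists_linearIndepOn_subset_hull {P : Set V} (hfin : P.Finite)
    (hunit : ∀ x ∈ P, ‖x‖ = 1) (hpos : ∀ x ∈ P, IsNonneg b x)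
    (hrefl : ∀ x ∈ P, ∀ y ∈ P, rootRefl x y ∈ P ∨ -(rootRefl x y) ∈ P) :
    ∃ D ⊆ P, LinearIndepOn ℝ id D ∧ P ⊆ PointedCone.hull ℝ D := by
  classical
  let C : Set (Finset V) := {D | (D : Set V) ⊆ P ∧ P ⊆ PointedCone.hull ℝ (D : Set V)}
  have hC : C.Nonempty := ⟨hfin.toFinset, by simp, by
    rw [hfin.coe_toFinset]; exact Submodule.subset_span⟩
  -- A smallest generating set of the cone is irredundant, which makes its angles non-acute and
  -- hence its vectors independent.
  obtain ⟨D, ⟨hDP, hPD⟩, hmin⟩ := (measure Finset.card).wf.has_min C hC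
  have hne : ∀ x ∈ P, x ≠ 0 := fun x hx h0 => by simpa [h0] using hunit x hx
  have hirr : ∀ a ∈ D, a ∉ PointedCone.hull ℝ ((D.erase a : Finset V) : Set V) := by
    intro a ha hmem
    refine hmin (D.erase a) ⟨fun x hx => hDP (Finset.mem_of_mem_erase hx), hPD.trans ?_⟩
      (Finset.card_erase_lt_of_mem ha)
    refine Submodule.span_le.mpr fun x hx => ?_
    by_cases hxa : x = a
    · rw [hxa]; exact hmem
    · exact Submodule.subset_span (Finset.mem_coe.mpr (Finset.mem_erase.mpr ⟨hxa, hx⟩))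
  have hsplit : ∀ a ∈ D, ∀ x ∈ P, ∃ r : ℝ, ∃ z ∈ PointedCone.hull ℝ ((D.erase a : Finset V) : Set V),
      x = r • a + z := by
    intro a ha x hx
    have h1 := hPD hx
    rw [← Finset.insert_erase ha, Finset.coe_insert, SetLike.mem_coe, Submodule.mem_span_insert] at h1
    obtain ⟨r, z, hz, h⟩ := h1
    exact ⟨r, z, hz, h⟩
  have hnonneg : ∀ a, ∀ z ∈ PointedCone.hull ℝ ((D.erase a : Finset V) : Set V), IsNonneg b z :=
    fun a z hz => isNonneg_of_mem_hull
      (fun x hx => hpos x (hDP (Finset.mem_of_mem_erase (Finset.mem_coe.mp hx)))) hz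
  -- A multiple `r • a` in the cone of the others contradicts pointedness if `r ≤ 0` and
  -- irredundancy if `r > 0`.
  have hcontra : ∀ a ∈ D, ∀ (r : ℝ), ∀ z ∈ PointedCone.hull ℝ ((D.erase a : Finset V) : Set V),
      z ≠ 0 → r • a ≠ z := by
    intro a ha r z hz hz0 h
    rcases le_or_gt r 0 with hr | hr
    · refine hz0 ((hnonneg a z hz).eq_zero ?_)
      rw [← h, ← neg_smul]
      exact (hpos a (hDP ha)).smul (by linarith)
    · refine hirr a ha ?_
      have h1 : r⁻¹ • z = a := by rw [← h, smul_smul, inv_mul_cancel₀ hr.ne', one_smul]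
      have h2 := hull_smul_mem (inv_nonneg.mpr hr.le) hz
      rwa [h1] at h2
  have hobt : ∀ a ∈ D, ∀ c ∈ D, a ≠ c → ⟪a, c⟫_ℝ ≤ 0 := by
    intro a ha c hc hac
    by_contra! hlt
    have ht : 0 < 2 * ⟪a, c⟫_ℝ := by linarith
    have hrc := rootRefl_apply (hunit a (hDP ha)) c
    set t := 2 * ⟪a, c⟫_ℝ
    have hmem : ∀ x ∈ D, ∀ y, x ≠ y → x ∈ PointedCone.hull ℝ ((D.erase y : Finset V) : Set V) :=
      fun x hx y hxy => Submodule.subset_span (Finset.mem_coe.mpr (Finset.mem_erase.mpr ⟨hxy, hx⟩))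
    -- If `c - t • a` is in `P`, isolating `c` writes a multiple of `c` as `t • a` plus other
    -- generators; if its negative is, isolate `a`.
    rcases hrefl a (hDP ha) c (hDP hc) with he | he
    · obtain ⟨x, y, hy, hxy⟩ := hsplit c hc _ he
      refine hcontra c hc (1 - x) (t • a + y)
        (Submodule.add_mem _ (hull_smul_mem ht.le (hmem a ha c hac)) hy) (fun h0 => ?_) ?_
      · have := ((hpos a (hDP ha)).smul ht.le).eq_zero_of_add (hnonneg c y hy) h0
        exact hne a (hDP ha) ((smul_eq_zero.mp this).resolve_left ht.ne')
      · rw [hrc] at hxy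
        rw [sub_smul, one_smul, sub_eq_iff_eq_add, add_assoc, add_comm y, ← hxy]
        abel
    · obtain ⟨x, y, hy, hxy⟩ := hsplit a ha _ he
      refine hcontra a ha (t - x) (c + y)
        (Submodule.add_mem _ (hmem c hc a hac.symm) hy) (fun h0 => ?_) ?_
      · exact hne c (hDP hc) ((hpos c (hDP hc)).eq_zero_of_add (hnonneg a y hy) h0)
      · rw [hrc] at hxy
        rw [sub_smul, sub_eq_iff_eq_add, add_assoc, add_comm y, ← hxy]
        abel
  refine ⟨D, hDP, ?_, hPD⟩
  obtain ⟨p, hp⟩ := exists_inner_basis_eq b fun _ => 1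
  -- Vectors in an open half-space with pairwise non-acute angles are independent.
  have hli := LinearMap.BilinForm.linearIndependent_of_pairwise_le_zero (R := ℝ)
    (innerₗ V) (by
      intro x hx
      exact real_inner_self_pos.mpr hx) (innerₗ V p) (fun x : D => (x : V))
    (fun x => by
      have := (hpos x (hDP x.2)).inner_pos (hne x (hDP x.2)) (y := p) fun i => by
        rw [real_inner_comm, hp]; exact one_pos
      rw [real_inner_comm] at this
      exact this)
    (fun x y hxy => hobt x x.2 y y.2 fun h => hxy (Subtype.ext h))
  exact hli

/-- A positive system contains at most one simple system. -/
lemma IsSimpleSystem.eq_of_isNonneg {G : Subgroup (V ≃ₗᵢ[ℝ] V)} {D D' : Set V}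
    (hD : IsSimpleSystem G D) (hD' : IsSimpleSystem G D') (hpos : ∀ x ∈ D, IsNonneg b x)
    (hpos' : ∀ x ∈ D', IsNonneg b x) : D = D' := by
  have mem_hull : ∀ {E : Set V}, IsSimpleSystem G E → (∀ x ∈ E, IsNonneg b x) →
      ∀ x ∈ roots G, IsNonneg b x → x ∈ PointedCone.hull ℝ E := by
    intro E hE hE' x hx hxp
    refine (hE.same_sign x hx).resolve_right fun h => ?_
    exact hxp.not_neg hx (isNonneg_of_mem_hull hE' h)
  have key : ∀ {E E' : Set V}, IsSimpleSystem G E → IsSimpleSystem G E' →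
      (∀ x ∈ E, IsNonneg b x) → (∀ x ∈ E', IsNonneg b x) → E ⊆ E' := by
    intro E E' hE hE' hp hp' x hx
    by_contra hxE'
    have hx0 : x ≠ 0 := ne_zero_of_mem_roots (hE.subset_roots hx)
    have hnn : ∀ z ∈ PointedCone.hull ℝ (E \ {x}), IsNonneg b z := fun z hz =>
      isNonneg_of_mem_hull (fun y hy => hp y hy.1) hz
    have hspan : x ∉ Submodule.span ℝ (E \ {x}) := by
      have h1 : LinearIndepOn ℝ id (insert x (E \ {x})) := by
        rw [Set.insert_sdiff_singleton, Set.insert_eq_of_mem hx]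
        exact hE.linearIndep
      simpa using h1.notMem_span_of_insert (by simp)
    have hxhull := mem_hull hE' hp' x (hE.subset_roots hx) (hp x hx)
    -- If `x ∉ E'`, no element of `E'` is a multiple of `x`, so each has a nonzero part `z` off `x`.
    -- Positivity preserves this under nonnegative combinations; for `x` itself it contradicts the
    -- independence of `E`.
    obtain ⟨r, hr, z, hz, hxz, hz0⟩ := hull_induction (S := E')
      (Q := fun v => ∃ r : ℝ, 0 ≤ r ∧ ∃ z ∈ PointedCone.hull ℝ (E \ {x}),
        v = r • x + z ∧ (z = 0 → v = 0)) (by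
        intro y hy
        have h1 := mem_hull hE hp y (hE'.subset_roots hy) (hp' y hy)
        rw [← Set.insert_eq_of_mem hx, ← Set.insert_sdiff_singleton, Submodule.mem_span_insert] at h1
        obtain ⟨r, z, hz, hyz⟩ := h1
        refine ⟨r, r.2, z, hz, hyz, fun h0 => absurd ?_ hxE'⟩
        have h2 : y = (r : ℝ) • x := by rw [hyz, h0, add_zero]; rfl
        have h3 : (r : ℝ) = 1 := by
          have := (hE'.subset_roots hy).1
          rwa [h2, norm_smul, (hE.subset_roots hx).1, mul_one, Real.norm_eq_abs,
            abs_of_nonneg r.2] at this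
        rw [h3, one_smul] at h2
        rwa [← h2]) ⟨0, le_rfl, 0, Submodule.zero_mem _, by simp, by simp⟩ (by
        rintro v w ⟨r, hr, z, hz, rfl, h0⟩ ⟨r', hr', z', hz', rfl, h0'⟩
        refine ⟨r + r', add_nonneg hr hr', z + z', Submodule.add_mem _ hz hz', by module,
          fun h => ?_⟩
        have h1 := (hnn z hz).eq_zero_of_add (hnn z' hz') h
        rw [h1, zero_add] at h
        rw [h0 h1, h0' h, add_zero]) (by
        rintro a ha v ⟨r, hr, z, hz, rfl, h0⟩
        refine ⟨a * r, mul_nonneg ha hr, a • z, hull_smul_mem ha hz, by module, fun h => ?_⟩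
        rcases smul_eq_zero.mp h with h | h
        · rw [h, zero_smul]
        · rw [h0 h, smul_zero]) hxhull
    have h1 : (1 - r) • x = z := by
      rw [sub_smul, one_smul, sub_eq_iff_eq_add, add_comm]; exact hxz
    have hzspan : z ∈ Submodule.span ℝ (E \ {x}) := PointedCone.hull_le_span ℝ _ hz
    by_cases hr1 : r = 1
    · rw [hr1, sub_self, zero_smul] at h1
      exact hx0 (hz0 h1.symm)
    · rw [← h1, Submodule.smul_mem_iff _ (sub_ne_zero.mpr (Ne.symm hr1))] at hzspan
      exact hspan hzspan
  exact (key hD hD' hpos hpos').antisymm (key hD' hD hpos' hpos)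

variable [NeZero n] {W : Subgroup (V ≃ₗᵢ[ℝ] V)}

lemma IsSimpleSystem.exists_subset_posRoots (hs : IsSimpleSystem W (Set.range b))
    (hfin : Finite W) (U : Submodule ℝ V) :
    ∃ D ⊆ {β | β ∈ posRoots b W ∧ β ∈ U}, IsSimpleSystem (movedSubgroup W U) D := by
  have hmem : ∀ β, β ∈ roots W → β ∈ U → β ∈ {β | β ∈ posRoots b W ∧ β ∈ U} ∨
      -β ∈ {β | β ∈ posRoots b W ∧ β ∈ U} := by
    intro β hβ hU
    rcases hs.isNonneg_or hβ with h | h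
    · exact Or.inl ⟨mem_posRoots_iff.mpr ⟨hβ, h⟩, hU⟩
    · exact Or.inr ⟨mem_posRoots_iff.mpr ⟨neg_mem_roots hβ, h⟩, U.neg_mem hU⟩
  obtain ⟨D, hD, hli, hhull⟩ := exists_linearIndepOn_subset_hull (b := b)
    (P := {β | β ∈ posRoots b W ∧ β ∈ U})
    ((hs.finite_roots hfin).subset fun β hβ => hβ.1.1) (fun β hβ => hβ.1.1.1)
    (fun β hβ => (mem_posRoots_iff.mp hβ.1).2) (by
      intro x hx y hy
      refine hmem _ (apply_mem_roots hx.1.1.2 hy.1.1) ?_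
      rw [rootRefl_apply hx.1.1.1]
      exact U.sub_mem hy.2 (U.smul_mem _ hx.2))
  refine ⟨D, hD, ?_, hli, ?_⟩
  · rw [roots_movedSubgroup]
    exact fun β hβ => ⟨(hD hβ).1.1, (hD hβ).2⟩
  · rw [roots_movedSubgroup]
    rintro β ⟨hβ, hU⟩
    exact (hmem β hβ hU).imp (fun h => hhull h) fun h => hhull h

end PositiveSystem

/-! ### The last root and the recursion. -/

section Recursion

variable {V : Type*} [NormedAddCommGroup V] [InnerProductSpace ℝ V] {n : ℕ} [NeZero n]
  {W : Subgroup (V ≃ₗᵢ[ℝ] V)} {b : Module.Basis (Fin n) ℝ V}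

/-- Appending `l` replaces `σ` by `σ R(l)` in the earlier conditions, which is what induction on `k`
uses. -/
lemma tailElt_snoc_castSucc {k : ℕ} (σ : V ≃ₗᵢ[ℝ] V) (δ : Fin k → V) (l : V) (i : Fin k) :
    tailElt σ (Fin.snoc (α := fun _ => V) δ l) i.castSucc = tailElt (σ * rootRefl l) δ i := by
  have h1 : List.ofFn (Fin.snoc (α := fun _ => V) δ l) = List.ofFn δ ++ [l] := by
    rw [List.ofFn_succ']
    simp
  rw [tailElt, tailElt, h1, Fin.val_castSucc, List.drop_append_of_le_length
    (by rw [List.length_ofFn]; exact i.2)]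
  simp [mul_assoc]

lemma tailElt_last {k : ℕ} (σ : V ≃ₗᵢ[ℝ] V) (δ : Fin k → V) (i : Fin k) (hi : (i : ℕ) + 1 = k) :
    tailElt σ δ i = σ := by
  rw [tailElt, hi, List.drop_of_length_le (by simp)]
  simp

lemma tailElt_congr {k : ℕ} (σ : V ≃ₗᵢ[ℝ] V) {δ δ' : Fin k → V} (i : Fin k)
    (h : ∀ j, i < j → δ j = δ' j) : tailElt σ δ i = tailElt σ δ' i := by
  have : (List.ofFn δ).drop (i + 1) = (List.ofFn δ').drop (i + 1) := by
    apply List.ext_getElem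
    · simp
    · intro m h1 h2
      simp only [List.getElem_drop, List.getElem_ofFn]
      exact h _ (by rw [Fin.lt_def]; simp; omega)
  rw [tailElt, tailElt, this]

variable (b) in
/-- The vectors `rho b j` with `j < nh / 2` are positive, distinct, and exhaust the positive
roots. -/
structure IsRhoEnumeration (W : Subgroup (V ≃ₗᵢ[ℝ] V)) : Prop where
  nonneg : ∀ j, j < n * orderOf (coxeterElt b) / 2 → IsNonneg b (rho b j)
  surj : ∀ β ∈ posRoots b W, ∃ j, j < n * orderOf (coxeterElt b) / 2 ∧ rho b j = β

lemma IsSimpleSystem.isRhoEnumeration (hs : IsSimpleSystem W (Set.range b))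
    (hW : IsFiniteIrreducibleReflectionGroup W) {s : ℕ} (hle : s ≤ n)
    (horth₁ : ∀ i j : Fin n, i ≠ j → (i : ℕ) < s → (j : ℕ) < s → ⟪b i, b j⟫_ℝ = 0)
    (horth₂ : ∀ i j : Fin n, i ≠ j → s ≤ (i : ℕ) → s ≤ (j : ℕ) → ⟪b i, b j⟫_ℝ = 0) :
    IsRhoEnumeration b W := by
  obtain ⟨h0, hpos, hneg⟩ := hs.rho_sign hW hle horth₁ horth₂
  refine ⟨hpos, fun β hβ => ?_⟩
  rw [mem_posRoots_iff] at hβ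
  obtain ⟨j, hj⟩ := hs.exists_rho_eq hW.finite hβ.1 hβ.2
  set h := orderOf (coxeterElt b) with hh
  have hn : 0 < n := Nat.pos_of_ne_zero (NeZero.ne n)
  -- The sequence has period `n h`, and its second half period consists of negative roots.
  have hmod : rho b (j % (n * h)) = rho b j := by
    conv_rhs => rw [← Nat.div_add_mod j (n * h), mul_assoc, rho_mul_add, pow_mul, hh,
      pow_orderOf_eq_one, one_pow]
    rfl
  have hlt : j % (n * h) < n * h := Nat.mod_lt _ (Nat.mul_pos hn h0)
  refine ⟨j % (n * h), ?_, hmod.trans hj⟩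
  by_contra! hge
  have h1 := hneg _ hge hlt
  rw [hmod, hj] at h1
  exact hβ.2.not_neg hβ.1 h1

lemma IsRhoEnumeration.rho_inj (he : IsRhoEnumeration b W) (hs : IsSimpleSystem W (Set.range b))
    {i j : ℕ} (hi : i < n * orderOf (coxeterElt b) / 2) (hj : j < n * orderOf (coxeterElt b) / 2)
    (h : rho b i = rho b j) : i = j := by
  rcases lt_trichotomy i j with hlt | heq | hlt
  · exact absurd h (hs.rho_ne he.nonneg hlt hj)
  · exact heq
  · exact absurd h.symm (hs.rho_ne he.nonneg hlt hi)

lemma IsRhoEnumeration.before_asymm (he : IsRhoEnumeration b W)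
    (hs : IsSimpleSystem W (Set.range b)) {β β' : V} (h : Before b β β') : ¬ Before b β' β := by
  rintro ⟨i', j', hij', hj', hi'β, hj'β⟩
  obtain ⟨i, j, hij, hj, hiβ, hjβ⟩ := h
  have h1 := he.rho_inj hs (by omega) hj (hi'β.trans hjβ.symm)
  have h2 := he.rho_inj hs (by omega) hj' (hiβ.trans hj'β.symm)
  omega

lemma IsRhoEnumeration.ne_of_before (he : IsRhoEnumeration b W)
    (hs : IsSimpleSystem W (Set.range b)) {β β' : V} (h : Before b β β') : β ≠ β' := by
  rintro rfl
  exact he.before_asymm hs h h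

lemma IsRhoEnumeration.isLastIn_unique (he : IsRhoEnumeration b W)
    (hs : IsSimpleSystem W (Set.range b)) {S : Set V} {β β' : V} (h : IsLastIn b S β)
    (h' : IsLastIn b S β') : β = β' := by
  by_contra hne
  exact he.before_asymm hs (h.2 β' h'.1 (Ne.symm hne)) (h'.2 β h.1 hne)

lemma IsRhoEnumeration.exists_isLastIn (he : IsRhoEnumeration b W) {S : Set V} (hS : S.Nonempty)
    (hSW : S ⊆ posRoots b W) : ∃ β, IsLastIn b S β := by
  classical
  let F : Finset ℕ := (Finset.range (n * orderOf (coxeterElt b) / 2)).filter fun j => rho b j ∈ S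
  have hF : F.Nonempty := by
    obtain ⟨β, hβ⟩ := hS
    obtain ⟨j, hj, rfl⟩ := he.surj β (hSW hβ)
    exact ⟨j, by simp [F, hj, hβ]⟩
  obtain ⟨m, hm, hmax⟩ := F.exists_max_image id hF
  have hm' : m < n * orderOf (coxeterElt b) / 2 ∧ rho b m ∈ S := by simpa [F] using hm
  refine ⟨rho b m, hm'.2, fun β hβ hne => ?_⟩
  obtain ⟨j, hj, rfl⟩ := he.surj β (hSW hβ)
  have hjm : j ≤ m := hmax j (by simp [F, hj, hβ])
  exact ⟨j, m, lt_of_le_of_ne hjm (by rintro rfl; exact hne rfl), hm'.1, rfl, rfl⟩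

/-- The `i`-th condition involves only later entries, so the entries are determined from the top
down. -/
lemma IsRhoEnumeration.recursion_unique (he : IsRhoEnumeration b W)
    (hs : IsSimpleSystem W (Set.range b)) {k : ℕ} {σ : V ≃ₗᵢ[ℝ] V} {δ δ' : Fin k → V}
    (h : SatisfiesRecursion b W σ δ) (h' : SatisfiesRecursion b W σ δ') : δ' = δ := by
  have key : ∀ m, ∀ i : Fin k, k - i = m → δ' i = δ i := by
    intro m
    induction m using Nat.strong_induction_on with
    | _ m ih =>
      intro i hi
      have h1 := h' i
      rw [tailElt_congr σ i fun j hij => ih (k - j) (by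
        have := Fin.lt_def.mp hij; have := j.2; omega) j rfl] at h1
      exact he.isLastIn_unique hs h1 (h i)
  funext i
  exact key _ i rfl

/-- The roots of a simple system on which a functional that is nonnegative on it vanishes span
the cone of all vectors on which this functional vanishes. -/
lemma mem_hull_of_apply_eq_zero {D : Set V} {f : V →ₗ[ℝ] ℝ} (hf : ∀ x ∈ D, 0 ≤ f x) {z : V}
    (hz : z ∈ PointedCone.hull ℝ D) (h0 : f z = 0) :
    z ∈ PointedCone.hull ℝ {x | x ∈ D ∧ f x = 0} := by
  refine (hull_induction (Q := fun v => 0 ≤ f v ∧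
    (f v = 0 → v ∈ PointedCone.hull ℝ {x | x ∈ D ∧ f x = 0})) ?_ ?_ ?_ ?_ hz).2 h0
  · exact fun x hx => ⟨hf x hx, fun h => Submodule.subset_span ⟨hx, h⟩⟩
  · exact ⟨by simp, fun _ => Submodule.zero_mem _⟩
  · rintro x y ⟨hx, hx'⟩ ⟨hy, hy'⟩
    rw [map_add]
    exact ⟨add_nonneg hx hy, fun h => Submodule.add_mem _ (hx' (by linarith)) (hy' (by linarith))⟩
  · rintro r hr x ⟨hx, hx'⟩
    rw [map_smul, smul_eq_mul]
    refine ⟨mul_nonneg hr hx, fun h => ?_⟩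
    rcases mul_eq_zero.mp h with h | h
    · rw [h, zero_smul]; exact Submodule.zero_mem _
    · exact hull_smul_mem hr (hx' h)

lemma IsSimpleSystem.ncard_le {U : Submodule ℝ V} {D : Set V} [FiniteDimensional ℝ V]
    (hD : IsSimpleSystem (movedSubgroup W U) D) (hDU : D ⊆ U) :
    D.Finite ∧ D.ncard ≤ Module.finrank ℝ U := by
  have hfin : D.Finite := LinearIndependent.setFinite hD.linearIndep
  refine ⟨hfin, ?_⟩
  have : Fintype D := hfin.fintype
  rw [Set.ncard_eq_toFinset_card', ← finrank_span_set_eq_card hD.linearIndep]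
  exact Submodule.finrank_mono (Submodule.span_le.mpr hDU)

/-- The simple system contained in the set of positive roots below `σ`, listed in increasing
order. -/
lemma IsRhoEnumeration.exists_simple (he : IsRhoEnumeration b W)
    (hs : IsSimpleSystem W (Set.range b)) (hfin : Finite W)
    (hgen : Subgroup.closure (reflections W) = W) {μ : V →ₗ[ℝ] V}
    (hμ : IsEulerMap (coxeterElt b) μ) (k : ℕ) (σ : V ≃ₗᵢ[ℝ] V) (hσ : σ ∈ W)
    (hle : absLE W σ (coxeterElt b)) (hk : Module.finrank ℝ (movedSpace σ) = k) :
    ∃ δ : Fin k → V, (∀ i j, i < j → Before b (δ i) (δ j)) ∧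
      Set.range δ ⊆ {β | β ∈ posRoots b W ∧ β ∈ movedSpace σ} ∧
      IsSimpleSystem (movedSubgroup W (movedSpace σ)) (Set.range δ) ∧
      SatisfiesRecursion b W σ δ := by
  have := b.finiteDimensional_of_finite
  induction k generalizing σ with
  | zero =>
    have hbot : movedSpace σ = ⊥ := Submodule.finrank_eq_zero.mp hk
    refine ⟨Fin.elim0, fun i => i.elim0, ?_, ⟨?_, ?_, ?_⟩, fun i => i.elim0⟩
    · rw [Set.range_eq_empty]; exact Set.empty_subset _
    · rw [Set.range_eq_empty]; exact Set.empty_subset _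
    · rw [Set.range_eq_empty]; exact linearIndepOn_empty ℝ id
    · rw [roots_movedSubgroup, hbot]
      rintro β ⟨hβ, hβ0⟩
      exact absurd ((Submodule.mem_bot ℝ).mp hβ0) (ne_zero_of_mem_roots hβ)
  | succ k ih =>
    set P : Set V := {β | β ∈ posRoots b W ∧ β ∈ movedSpace σ} with hP
    obtain ⟨D, hDP, hD⟩ := hs.exists_subset_posRoots hfin (movedSpace σ)
    have hDhull : ∀ β ∈ P, β ∈ PointedCone.hull ℝ D := by
      intro β hβ
      refine (hD.same_sign β (by rw [roots_movedSubgroup]; exact ⟨hβ.1.1, hβ.2⟩)).resolve_right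
        fun h => ?_
      exact (mem_posRoots_iff.mp hβ.1).2.not_neg hβ.1.1
        (isNonneg_of_mem_hull (fun x hx => (mem_posRoots_iff.mp (hDP hx).1).2) h)
    have hPne : P.Nonempty := by
      obtain ⟨β, hβ, hβσ⟩ := hs.exists_root_mem_movedSpace hfin hgen hσ (by
        rintro rfl
        rw [movedSpace_one, finrank_bot] at hk
        omega)
      rcases hs.isNonneg_or hβ with h | h
      · exact ⟨β, mem_posRoots_iff.mpr ⟨hβ, h⟩, hβσ⟩
      · exact ⟨-β, mem_posRoots_iff.mpr ⟨neg_mem_roots hβ, h⟩, Submodule.neg_mem _ hβσ⟩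
    obtain ⟨l, hlP, hlast⟩ := he.exists_isLastIn hPne fun β hβ => hβ.1
    have hlroot : l ∈ roots W := hlP.1.1
    have hll : ⟪μ l, l⟫_ℝ = 1 := by
      rw [hμ.inner_self, real_inner_self_eq_norm_sq, hlroot.1, one_pow]
    -- Otherwise all of `D` precedes `l`, so `⟪μ l, ·⟫ ≤ 0` on the cone of `D`, which contains `l`.
    have hlD : l ∈ D := by
      by_contra hlD
      have h1 : ∀ x ∈ D, ⟪μ l, x⟫_ℝ ≤ 0 := by
        intro x hx
        obtain ⟨i, j, hij, hj, rfl, rfl⟩ := hlast x (hDP hx) (by rintro rfl; exact hlD hx)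
        exact hs.inner_eulerMap_nonpos hμ he.nonneg hij hj
      have h2 : ⟪μ l, l⟫_ℝ ≤ 0 := by
        refine hull_induction (Q := fun v => ⟪μ l, v⟫_ℝ ≤ 0) h1 (by simp) ?_ ?_ (hDhull l hlP)
        · intro x y hx hy
          rw [inner_add_right]; linarith
        · intro r hr x hx
          rw [real_inner_smul_right]
          exact mul_nonpos_of_nonneg_of_nonpos hr hx
      linarith
    obtain ⟨hσ', hle', hrank, hmem⟩ := hs.mul_rootRefl_below hfin hgen hσ hle hμ hlroot hlP.2
    obtain ⟨δ, hδlt, hδP, hδs, hδr⟩ := ih (σ * rootRefl l) hσ' hle' (by omega)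
    have hsub : {β | β ∈ posRoots b W ∧ β ∈ movedSpace (σ * rootRefl l)} ⊆ P := fun β hβ =>
      ⟨hβ.1, ((hmem β).mp hβ.2).1⟩
    -- Here `μ` is applied to the variable: `f` is nonnegative on `D`, and its kernel meets `M(σ)`
    -- in `M(σ R(l))`.
    let f : V →ₗ[ℝ] ℝ := (innerₛₗ ℝ l) ∘ₗ μ
    have hf : ∀ v, f v = ⟪μ v, l⟫_ℝ := fun v => real_inner_comm _ _
    have hfD : ∀ x ∈ D, 0 ≤ f x := by
      intro x hx
      rw [hf]
      by_cases hxl : x = l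
      · rw [hxl, hll]; exact zero_le_one
      · obtain ⟨i, j, hij, hj, rfl, rfl⟩ := hlast x (hDP hx) hxl
        exact hs.inner_eulerMap_nonneg hμ he.nonneg hij.le hj
    have hD₀ : IsSimpleSystem (movedSubgroup W (movedSpace (σ * rootRefl l)))
        {x | x ∈ D ∧ f x = 0} := by
      refine ⟨?_, hD.linearIndep.mono fun x hx => hx.1, ?_⟩
      · rw [roots_movedSubgroup]
        rintro x ⟨hx, hx0⟩
        exact ⟨(hDP hx).1.1, (hmem x).mpr ⟨(hDP hx).2, by rw [← hf]; exact hx0⟩⟩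
      · rw [roots_movedSubgroup]
        rintro β ⟨hβ, hβσ⟩
        obtain ⟨h1, h2⟩ := (hmem β).mp hβσ
        rw [← hf] at h2
        refine (hD.same_sign β (by rw [roots_movedSubgroup]; exact ⟨hβ, h1⟩)).imp
          (fun h => mem_hull_of_apply_eq_zero hfD h h2)
          fun h => mem_hull_of_apply_eq_zero hfD h (by rw [map_neg, h2, neg_zero])
    have hD₀δ : {x | x ∈ D ∧ f x = 0} = Set.range δ :=
      hD₀.eq_of_isNonneg hδs (fun x hx => (mem_posRoots_iff.mp (hDP hx.1).1).2)
        fun x hx => (mem_posRoots_iff.mp (hδP hx).1).2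
    have hlδ : l ∉ Set.range δ := by
      rw [← hD₀δ]
      rintro ⟨-, h⟩
      rw [hf, hll] at h
      exact one_ne_zero h
    -- `D` contains `l` and the `k` roots `δ i`, and independence in `M(σ)` leaves room for no more
    -- than `k + 1`.
    have hrange : Set.range (Fin.snoc (α := fun _ => V) δ l) = D := by
      rw [Fin.range_snoc]
      obtain ⟨hDfin, hDcard⟩ := hD.ncard_le fun x hx => (hDP hx).2
      refine Set.eq_of_subset_of_ncard_le ?_ ?_ hDfin
      · refine Set.insert_subset hlD ?_
        rw [← hD₀δ]
        exact fun x hx => hx.1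
      · have hinj : Function.Injective δ := by
          intro i j hij
          rcases lt_trichotomy i j with h | h | h
          · exact absurd hij (he.ne_of_before hs (hδlt i j h))
          · exact h
          · exact absurd hij.symm (he.ne_of_before hs (hδlt j i h))
        rw [Set.ncard_insert_of_notMem hlδ (Set.finite_range δ), Set.ncard_range_of_injective hinj]
        simpa [hk] using hDcard
    refine ⟨Fin.snoc (α := fun _ => V) δ l, ?_, by rw [hrange]; exact hDP, by rwa [hrange], ?_⟩
    · intro i j hij
      induction j using Fin.lastCases with
      | last =>
        induction i using Fin.lastCases with
        | last => exact absurd hij (lt_irrefl _)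
        | cast i =>
          rw [Fin.snoc_castSucc, Fin.snoc_last]
          exact hlast _ (hsub (hδP ⟨i, rfl⟩)) fun h => hlδ ⟨i, h⟩
      | cast j =>
        induction i using Fin.lastCases with
        | last => exact absurd hij (not_lt.mpr (Fin.le_last _))
        | cast i =>
          rw [Fin.snoc_castSucc, Fin.snoc_castSucc]
          exact hδlt i j hij
    · intro i
      induction i using Fin.lastCases with
      | last =>
        rw [tailElt_last _ _ _ (by simp), Fin.snoc_last]
        exact ⟨hlP, hlast⟩
      | cast i =>
        rw [tailElt_snoc_castSucc, Fin.snoc_castSucc]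
        exact hδr i

end Recursion

end BradyWatt

end

/-! ### The theorem. -/

theorem theorem5p1 (n : ℕ) [NeZero n]
    (W : Subgroup (EuclideanSpace ℝ (Fin n) ≃ₗᵢ[ℝ] EuclideanSpace ℝ (Fin n)))
    (hW : BradyWatt.IsFiniteIrreducibleReflectionGroup W)
    -- the simple roots, split into two orthonormal sets
    (α : Fin n → EuclideanSpace ℝ (Fin n)) (hinj : Function.Injective α)
    (hα : BradyWatt.IsSimpleSystem W (Set.range α))
    (s : ℕ) (hs : s ≤ n)
    (hS₁ : ∀ i j : Fin n, i ≠ j → (i : ℕ) < s → (j : ℕ) < s → inner ℝ (α i) (α j) = 0)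
    (hS₂ : ∀ i j : Fin n, i ≠ j → s ≤ (i : ℕ) → s ≤ (j : ℕ) → inner ℝ (α i) (α j) = 0)
    (σ : EuclideanSpace ℝ (Fin n) ≃ₗᵢ[ℝ] EuclideanSpace ℝ (Fin n)) (hσW : σ ∈ W)
    (hσ : BradyWatt.absLE W σ (BradyWatt.coxeterElt α))
    (k : ℕ) (hk : BradyWatt.reflLength W σ = k) :
    ∃ δ : Fin k → EuclideanSpace ℝ (Fin n),
      -- `δ` lists, in increasing order, the simple system contained in `P`
      (∀ i j : Fin k, i < j → BradyWatt.Before α (δ i) (δ j)) ∧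
      (∀ Δ : Set (EuclideanSpace ℝ (Fin n)),
        (Δ ⊆ BradyWatt.posRootsBelow α W σ ∧
          BradyWatt.IsSimpleSystem
            (BradyWatt.movedSubgroup W (BradyWatt.movedSpace σ)) Δ) ↔ Δ = Set.range δ) ∧
      -- the recursion, which determines `δ`
      BradyWatt.SatisfiesRecursion α W σ δ ∧
      (∀ δ' : Fin k → EuclideanSpace ℝ (Fin n),
        BradyWatt.SatisfiesRecursion α W σ δ' → δ' = δ) ∧
      -- the last simple root is the last root of `P`
      (∀ i : Fin k, (i : ℕ) + 1 = k →
        BradyWatt.IsLastIn α (BradyWatt.posRootsBelow α W σ) (δ i)) := by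
  have hli : LinearIndependent ℝ α := by
    have h1 : LinearIndepOn ℝ id (Set.range α) := hα.linearIndep
    exact (linearIndepOn_id_range_iff hinj).mp h1
  obtain ⟨b, rfl⟩ : ∃ b : Module.Basis (Fin n) ℝ (EuclideanSpace ℝ (Fin n)), ⇑b = α :=
    ⟨basisOfLinearIndependentOfCardEqFinrank hli (by simp),
      coe_basisOfLinearIndependentOfCardEqFinrank hli (by simp)⟩
  have he := hα.isRhoEnumeration hW hs hS₁ hS₂
  obtain ⟨μ, hμ⟩ := BradyWatt.exists_eulerMap fun x hx => hα.eq_zero_of_coxeterElt_fixed hx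
  rw [hα.reflLength_eq hW.finite hW.generated hσW] at hk
  obtain ⟨δ, hlt, hP, hsim, hrec⟩ := he.exists_simple hα hW.finite hW.generated hμ k σ hσW hσ hk
  rw [hα.posRootsBelow_eq hW.finite hW.generated hσW]
  refine ⟨δ, hlt, fun Δ => ⟨fun h => ?_, ?_⟩, hrec, fun δ' h => he.recursion_unique hα hrec h, ?_⟩
  · exact h.2.eq_of_isNonneg hsim (fun x hx => (BradyWatt.mem_posRoots_iff.mp (h.1 hx).1).2)
      fun x hx => (BradyWatt.mem_posRoots_iff.mp (hP hx).1).2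
  · rintro rfl
    exact ⟨hP, hsim⟩
  -- At the last index the tail product is empty, so the recursion speaks of `M(σ)` itself.
  · intro i hi
    have := hrec i
    rwa [BradyWatt.tailElt_last σ δ i hi] at this
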